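/- **Theorem (Hamilton equations on Lie algebroids).** Let $(E,[\![\cdot,\cdot]\!],\rho)$ be a Lie algebroid of rank $m$ over a smooth (Hausdorff) manifold $Q$ of dimension $n$, let $k\ge 0$, and put $P=\mathbb R^k\times(E^*\oplus\overset{k}{\cdots}\oplus E^*)$, with points $(\mathbf t,e^*_{1},\dots,e^*_{k})$, $e^*_A\in E^*_q$, and projection $\tilde p:P\to Q$, $(\mathbf t,e_1^*,\dots,e_k^*)\mapsto q$. Let $$\mathcal T^EP=\{(a,v)\in E_{\tilde p(p)}\times T_pP \mid p\in P,\ \rho(a)=T_p\tilde p(v)\}$$ be the prolongation of $E$ over $\tilde p$, i.e. the Lie algebroid over $P$ with anchor $(a,v)\mapsto v$ and with the bracket determined by the Leibniz rule and $[\![(\sigma,X),(\tau,Y)]\!]=([\![\sigma,\tau]\!],[X,Y])$ on projectable sections; let $\mathrm d$ be its exterior differential. Define $1$-sections of $\mathcal T^EP$ by $\mathcal Y^A(a,v)=v(t^A)$ and $\Theta^A_{(\mathbf t,e_1^*,\dots,e_k^*)}(a,v)=e^*_A(a)$, and put $\Omega^A=-\mathrm d\Theta^A$, $1\le A\le k$.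 Let $H:P\to\mathbb R$ be a smooth function and let $\xi_1,\dots,\xi_k$ be smooth sections of $\mathcal T^EP\to P$ such that $$\mathcal Y^B(\xi_A)=\delta^B_A,\qquad \sum_{A=1}^k \imath_{\xi_A}\Omega^A=\mathrm dH-\sum_{A=1}^k\frac{\partial H}{\partial t^A}\,\mathcal Y^A .$$ Let $\psi:W\to P$, with $W\subseteq\mathbb R^k$ open, be an integral section of $(\xi_1,\dots,\xi_k)$, that is, a differentiable map such that $\psi_*(\mathbf t)\big(\partial/\partial t^A|_{\mathbf t}\big)$ is the $TP$-component of $\xi_A(\psi(\mathbf t))$ for all $\mathbf t\in W$ and all $A$. Let $(q^i)$ be local coordinates on an open set $U\subseteq Q$ and $(e_\alpha)$ a local basis of sections of $E$ on $U$, with $\rho(e_\alpha)=\rho^i_\alpha\,\partial/\partial q^i$ and $[\![e_\alpha,e_\beta]\!]=\mathcal C^\gamma_{\alpha\beta}e_\gamma$; let $(t^A,q^i,y^A_\alpha)$, $y^A_\alpha=e^*_A(e_\alpha)$, be the induced coordinates on $\tilde p^{-1}(U)$, and write $\psi^i=q^i\circ\psi$, $\psi^A_\alpha=y^A_\alpha\circ\psi$.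 Then, at every $\mathbf t\in W$ with $\tilde p(\psi(\mathbf t))\in U$ (summing over repeated algebroid and coordinate indices), $$\frac{\partial\psi^i}{\partial t^A}\Big|_{\mathbf t}=\rho^i_\alpha\,\frac{\partial H}{\partial y^A_\alpha}\Big|_{\psi(\mathbf t)}\quad(1\le i\le n,\ 1\le A\le k),$$ $$\sum_{A=1}^k\frac{\partial\psi^A_\beta}{\partial t^A}\Big|_{\mathbf t}=-\Big(\rho^i_\beta\,\frac{\partial H}{\partial q^i}\Big|_{\psi(\mathbf t)}+\sum_{A=1}^k\psi^A_\gamma(\mathbf t)\,\mathcal C^\gamma_{\beta\alpha}\,\frac{\partial H}{\partial y^A_\alpha}\Big|_{\psi(\mathbf t)}\Big)\quad(1\le\beta\le m),$$ where $\rho^i_\alpha$ and $\mathcal C^\gamma_{\beta\alpha}$ are taken at $\tilde p(\psi(\mathbf t))$. -/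

import Mathlib

open Bundle Set Filter Topology
open scoped Manifold ContDiff Topology Bundle

noncomputable section

/-! ## The Whitney sum of `k` copies of a vector bundle -/

section WhitneySum

/-- The fibre over `x` of the Whitney sum `E ⊕ ⋯ ⊕ E` of `k` copies of a bundle `E`. -/
def WhitneySum (k : ℕ) {B : Type*} (E : B → Type*) (x : B) : Type _ := Fin k → E x

namespace WhitneySum

variable {k : ℕ} {B : Type*} {E : B → Type*}

instance [∀ x, AddCommGroup (E x)] (x : B) : AddCommGroup (WhitneySum k E x) :=
  inferInstanceAs (AddCommGroup (Fin k → E x))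

instance [∀ x, AddCommGroup (E x)] [∀ x, Module ℝ (E x)] (x : B) : Module ℝ (WhitneySum k E x) :=
  inferInstanceAs (Module ℝ (Fin k → E x))

instance [∀ x, TopologicalSpace (E x)] (x : B) : TopologicalSpace (WhitneySum k E x) :=
  inferInstanceAs (TopologicalSpace (Fin k → E x))

variable [TopologicalSpace B]
  {F : Type*} [NormedAddCommGroup F] [NormedSpace ℝ F]
  [∀ x, AddCommGroup (E x)] [∀ x, Module ℝ (E x)]
  [TopologicalSpace (TotalSpace F E)]

/-- The pretrivialization of the Whitney sum that applies a given trivialization of `E` to each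
of the `k` components. -/
def pretrivialization (k : ℕ) (e : Trivialization F (π F E)) [e.IsLinear ℝ] :
    Pretrivialization (Fin k → F) (π (Fin k → F) (WhitneySum k E)) where
  toFun p := ⟨p.1, fun A ↦ e.linearMapAt ℝ p.1 (p.2 A)⟩
  invFun p := ⟨p.1, fun A ↦ e.symmₗ ℝ p.1 (p.2 A)⟩
  source := TotalSpace.proj ⁻¹' e.baseSet
  target := e.baseSet ×ˢ Set.univ
  map_source' := fun ⟨_, _⟩ h ↦ ⟨h, Set.mem_univ _⟩
  map_target' := fun ⟨_, _⟩ h ↦ h.1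
  left_inv' := fun ⟨x, L⟩ h ↦ by
    refine congrArg (TotalSpace.mk x) (funext fun A ↦ ?_)
    exact e.symmₗ_linearMapAt h (L A)
  right_inv' := fun ⟨x, f⟩ ⟨h, _⟩ ↦ by
    simp only [Prod.mk_right_inj]
    funext A
    exact e.linearMapAt_symmₗ h (f A)
  open_target := e.open_baseSet.prod isOpen_univ
  baseSet := e.baseSet
  open_baseSet := e.open_baseSet
  source_eq := rfl
  target_eq := rfl
  proj_toFun _ _ := rfl

instance (e : Trivialization F (π F E)) [e.IsLinear ℝ] :
    (pretrivialization k e).IsLinear ℝ where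
  linear x _ :=
    { map_add := fun L L' ↦ funext fun A ↦ (e.linearMapAt ℝ x).map_add (L A) (L' A)
      map_smul := fun c L ↦ funext fun A ↦ (e.linearMapAt ℝ x).map_smul c (L A) }

/-- The continuous linear map `L ↦ L ⊕ ⋯ ⊕ L`. -/
def diagL (k : ℕ) (F : Type*) [NormedAddCommGroup F] [NormedSpace ℝ F] :
    (F →L[ℝ] F) →L[ℝ] ((Fin k → F) →L[ℝ] (Fin k → F)) :=
  ∑ A : Fin k,
    (ContinuousLinearMap.compL ℝ (Fin k → F) F (Fin k → F)
        (ContinuousLinearMap.single ℝ (fun _ : Fin k ↦ F) A)).comp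
      ((ContinuousLinearMap.compL ℝ (Fin k → F) F F).flip
        (ContinuousLinearMap.proj (R := ℝ) (φ := fun _ : Fin k ↦ F) A))

theorem diagL_apply (L : F →L[ℝ] F) (v : Fin k → F) (A : Fin k) :
    diagL k F L v A = L (v A) := by
  simp [diagL, Finset.sum_apply, Pi.single_apply]

theorem diagL_coordChange (e e' : Trivialization F (π F E)) [e.IsLinear ℝ] [e'.IsLinear ℝ]
    (b : B) (hb : b ∈ e.baseSet ∩ e'.baseSet) (v : Fin k → F) :
    diagL k F (e.coordChangeL ℝ e' b : F →L[ℝ] F) v =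
      (pretrivialization k e' ⟨b, (pretrivialization k e).symm b v⟩).2 := by
  funext A
  rw [diagL_apply, Pretrivialization.symm_apply _ hb.1]
  change _ = e'.linearMapAt ℝ b (e.symmₗ ℝ b (v A))
  rw [ContinuousLinearEquiv.coe_coe, e.coordChangeL_apply e' hb, e.symmₗ_apply hb.1,
    e'.coe_linearMapAt_of_mem hb.2]

variable [∀ x, TopologicalSpace (E x)] [FiberBundle F E] [VectorBundle ℝ F E]

variable (k E F) in
/-- The vector prebundle structure of the Whitney sum. -/
def vectorPrebundle : VectorPrebundle ℝ (Fin k → F) (WhitneySum k E) where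
  pretrivializationAtlas :=
    {e' | ∃ (e : Trivialization F (π F E)) (_ : MemTrivializationAtlas e),
      e' = pretrivialization k e}
  pretrivialization_linear' := by
    rintro _ ⟨e, he, rfl⟩
    infer_instance
  pretrivializationAt x := pretrivialization k (trivializationAt F E x)
  mem_base_pretrivializationAt x := FiberBundle.mem_baseSet_trivializationAt F E x
  pretrivialization_mem_atlas x := ⟨trivializationAt F E x, inferInstance, rfl⟩
  exists_coordChange := by
    rintro _ ⟨e, he, rfl⟩ _ ⟨e', he', rfl⟩
    exact ⟨fun b ↦ diagL k F (e.coordChangeL ℝ e' b : F →L[ℝ] F),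
      (diagL k F).continuous.comp_continuousOn (continuousOn_coordChange ℝ e e'),
      diagL_coordChange e e'⟩
  totalSpaceMk_isInducing b := by
    let L : E b ≃L[ℝ] F := (trivializationAt F E b).continuousLinearEquivAt ℝ b
      (FiberBundle.mem_baseSet_trivializationAt F E b)
    let φ : (Fin k → E b) ≃ₜ (Fin k → F) := Homeomorph.piCongrRight fun _ ↦ L.toHomeomorph
    have h : IsInducing fun x ↦ (b, φ x) := isInducing_const_prod.mpr φ.isInducing
    have h' : pretrivialization k (trivializationAt F E b) ∘ TotalSpace.mk b =
        fun x ↦ (b, φ x) := by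
      funext x
      refine Prod.ext rfl (funext fun A ↦ ?_)
      exact congrFun ((trivializationAt F E b).coe_linearMapAt_of_mem (R := ℝ)
        (FiberBundle.mem_baseSet_trivializationAt F E b)) (x A)
    rw [h']
    exact h

instance : TopologicalSpace (TotalSpace (Fin k → F) (WhitneySum k E)) :=
  (vectorPrebundle k E F).totalSpaceTopology

instance : FiberBundle (Fin k → F) (WhitneySum k E) :=
  (vectorPrebundle k E F).toFiberBundle

instance : VectorBundle ℝ (Fin k → F) (WhitneySum k E) :=
  (vectorPrebundle k E F).toVectorBundle

variable {EB : Type*} [NormedAddCommGroup EB] [NormedSpace ℝ EB] {HB : Type*} [TopologicalSpace HB]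
  {IB : ModelWithCorners ℝ EB HB} [ChartedSpace HB B]

instance {n : ℕ∞ω} [ContMDiffVectorBundle n F E IB] :
    (vectorPrebundle k E F).IsContMDiff IB n where
  exists_contMDiffCoordChange := by
    rintro _ ⟨e, he, rfl⟩ _ ⟨e', he', rfl⟩
    exact ⟨fun b ↦ diagL k F (e.coordChangeL ℝ e' b : F →L[ℝ] F),
      (diagL k F).contMDiff.comp_contMDiffOn (contMDiffOn_coordChangeL e e'),
      diagL_coordChange e e'⟩

instance {n : ℕ∞ω} [ContMDiffVectorBundle n F E IB] :
    ContMDiffVectorBundle n (Fin k → F) (WhitneySum k E) IB :=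
  (vectorPrebundle k E F).contMDiffVectorBundle IB

end WhitneySum

end WhitneySum

/-- The derivative `v(f)` of a real function `f` at the point `p` along the tangent vector `v`. -/
def dirDeriv {EP HP P : Type*} [NormedAddCommGroup EP] [NormedSpace ℝ EP] [TopologicalSpace HP]
    (J : ModelWithCorners ℝ EP HP) [TopologicalSpace P] [ChartedSpace HP P]
    (f : P → ℝ) (p : P) (v : TangentSpace J p) : ℝ :=
  mfderiv J 𝓘(ℝ) f p v

/-! ## Lie algebroids -/

section LieAlgebroid

variable {n m : ℕ} {Q : Type*} [TopologicalSpace Q] [ChartedSpace (EuclideanSpace ℝ (Fin n)) Q]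
  [IsManifold (𝓡 n) ∞ Q]
  {E : Q → Type*} [∀ q, AddCommGroup (E q)] [∀ q, Module ℝ (E q)] [∀ q, TopologicalSpace (E q)]
  [TopologicalSpace (TotalSpace (EuclideanSpace ℝ (Fin m)) E)]
  [FiberBundle (EuclideanSpace ℝ (Fin m)) E] [VectorBundle ℝ (EuclideanSpace ℝ (Fin m)) E]

variable (n m E) in
/-- `Sec(E)`: smooth sections of the rank `m` vector bundle `E` over the `n`-manifold `Q`. -/
abbrev Sec := ContMDiffSection (𝓡 n) (EuclideanSpace ℝ (Fin m)) ∞ E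

variable (n m E) in
/-- A Lie algebroid structure on `E`: a Lie bracket on `Sec(E)` and an anchor `E → TQ`, a smooth
vector bundle map over the identity, satisfying the Leibniz rule. -/
structure LieAlgebroid where
  /-- The Lie bracket of smooth sections. -/
  bracket : Sec n m E →ₗ[ℝ] Sec n m E →ₗ[ℝ] Sec n m E
  bracket_self : ∀ σ, bracket σ σ = 0
  jacobi : ∀ σ τ υ,
    bracket σ (bracket τ υ) + bracket τ (bracket υ σ) + bracket υ (bracket σ τ) = 0
  /-- The anchor. -/
  anchor : ∀ q, E q →ₗ[ℝ] TangentSpace (𝓡 n) q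
  anchor_smooth : ContMDiff ((𝓡 n).prod 𝓘(ℝ, EuclideanSpace ℝ (Fin m))) (𝓡 n).tangent ∞
    (fun e : TotalSpace (EuclideanSpace ℝ (Fin m)) E ↦
      (⟨e.1, anchor e.1 e.2⟩ : TangentBundle (𝓡 n) Q))
  /-- `⟦σ, f τ⟧ = f ⟦σ, τ⟧ + (ρ(σ) f) τ`. -/
  leibniz : ∀ (f : Q → ℝ) (hf : ContMDiff (𝓡 n) 𝓘(ℝ) ∞ f) (σ τ : Sec n m E) (q : Q),
    bracket σ ⟨f • ⇑τ, hf.smul_section τ.contMDiff⟩ q =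
      f q • bracket σ τ q + dirDeriv (𝓡 n) f q (anchor q (σ q)) • τ q

namespace LieAlgebroid

variable (𝔄 : LieAlgebroid n m E)

open Classical in
/-- The bracket at `q` of two sections `s`, `s'` that are only smooth near `q`: the bracket of any
global smooth sections with the same germs at `q`. -/
def localBracket (s s' : ∀ q, E q) (q : Q) : E q :=
  if h : ∃ σ : Sec n m E × Sec n m E, (∀ᶠ x in 𝓝 q, σ.1 x = s x) ∧ ∀ᶠ x in 𝓝 q, σ.2 x = s' x
  then 𝔄.bracket h.choose.1 h.choose.2 q else 0

/-! ### Structure functions in local coordinates -/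

/-- `ρ^i_α`, where `ρ(e_α) = ρ^i_α ∂/∂q^i` in the coordinates `(q^i)` given by `φ`. -/
def anchorCoeff (φ : OpenPartialHomeomorph Q (EuclideanSpace ℝ (Fin n)))
    (e : Fin m → ∀ q, E q) (i : Fin n) (α : Fin m) (q : Q) : ℝ :=
  dirDeriv (𝓡 n) (fun x ↦ φ x i) q (𝔄.anchor q (e α q))

/-- `𝒞^γ_{αβ}`, where `⟦e_α, e_β⟧ = 𝒞^γ_{αβ} e_γ`. -/
def bracketCoeff {e : Fin m → ∀ q, E q} {U : Set Q}
    (he : IsLocalFrameOn (𝓡 n) (EuclideanSpace ℝ (Fin m)) ∞ e U) (γ α β : Fin m) (q : Q) : ℝ :=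
  he.coeff γ q (𝔄.localBracket (e α) (e β) q)

/-! ### The prolongation of a Lie algebroid over a fibration -/

variable {EP HP P : Type*} [NormedAddCommGroup EP] [NormedSpace ℝ EP] [TopologicalSpace HP]
  (J : ModelWithCorners ℝ EP HP) [TopologicalSpace P] [ChartedSpace HP P] [IsManifold J ∞ P]
  (pr : P → Q)

/-- The fibre `𝒯^E_p P = {(a, v) ∈ E_{pr p} × T_p P | ρ(a) = T_p pr (v)}` of the prolongation. -/
def prolongation (p : P) : Submodule ℝ (E (pr p) × TangentSpace J p) :=
  LinearMap.eqLocus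
    ((𝔄.anchor (pr p)).comp (LinearMap.fst ℝ (E (pr p)) (TangentSpace J p)))
    ((mfderiv J (𝓡 n) pr p).toLinearMap.comp (LinearMap.snd ℝ (E (pr p)) (TangentSpace J p)))

/-- `Z` is a smooth section of the prolongation over the set `W`. -/
structure IsProlongationSection (Z : ∀ p, E (pr p) × TangentSpace J p) (W : Set P) : Prop where
  mem : ∀ p ∈ W, Z p ∈ 𝔄.prolongation J pr p
  smooth_fst : ContMDiffOn J ((𝓡 n).prod 𝓘(ℝ, EuclideanSpace ℝ (Fin m))) ∞
    (fun p ↦ (⟨pr p, (Z p).1⟩ : TotalSpace (EuclideanSpace ℝ (Fin m)) E)) W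
  smooth_snd : ContMDiffOn J J.tangent ∞ (fun p ↦ (⟨p, (Z p).2⟩ : TangentBundle J P)) W

/-- The components of `(Z p).1` near `p₀` in the frame of `E` near `pr p₀` given by the preferred
trivialization. -/
def frameComponents (Z : ∀ p, E (pr p) × TangentSpace J p) (p₀ p : P) : EuclideanSpace ℝ (Fin m) :=
  (trivializationAt (EuclideanSpace ℝ (Fin m)) E (pr p₀) ⟨pr p, (Z p).1⟩).2

/-- The Lie bracket of the prolongation. If `Z = (a^α e_α, v)` and `Z' = (b^α e_α, w)` for a local
frame `e_α` of `E` with `⟦e_α, e_β⟧ = 𝒞^γ_{αβ} e_γ`, then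
`⟦Z, Z'⟧ = ((v(b^γ) - w(a^γ) + 𝒞^γ_{αβ} a^α b^β) e_γ, [v, w])`.
This is the unique bracket that extends `⟦(σ, v), (τ, w)⟧ = (⟦σ, τ⟧, [v, w])` from projectable
sections by the Leibniz rule; it does not depend on the frame. -/
def prolongationBracket (Z Z' : ∀ p, E (pr p) × TangentSpace J p) (p : P) :
    E (pr p) × TangentSpace J p :=
  let triv := trivializationAt (EuclideanSpace ℝ (Fin m)) E (pr p)
  let e := triv.localFrame (EuclideanSpace.basisFun (Fin m) ℝ).toBasis
  let a := frameComponents J pr Z p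
  let b := frameComponents J pr Z' p
  let vb : EuclideanSpace ℝ (Fin m) :=
    mfderiv J 𝓘(ℝ, EuclideanSpace ℝ (Fin m)) b p (Z p).2
  let wa : EuclideanSpace ℝ (Fin m) :=
    mfderiv J 𝓘(ℝ, EuclideanSpace ℝ (Fin m)) a p (Z' p).2
  (∑ γ, (vb γ - wa γ) • e γ (pr p) +
      ∑ α, ∑ β, (a p α * b p β) • 𝔄.localBracket (e α) (e β) (pr p),
    VectorField.mlieBracket J (fun p ↦ (Z p).2) (fun p ↦ (Z' p).2) p)

/-- The exterior differential of the prolongation on functions, `(d f)(Z) = ρ(Z) f`, where the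
anchor `ρ` of the prolongation is the projection `(a, v) ↦ v`. -/
def dFun (f : P → ℝ) (Z : ∀ p, E (pr p) × TangentSpace J p) (p : P) : ℝ :=
  dirDeriv J f p (Z p).2

/-- The exterior differential of the prolongation on `1`-sections,
`(d μ)(Z, Z') = ρ(Z) μ(Z') - ρ(Z') μ(Z) - μ(⟦Z, Z'⟧)`. -/
def dOne (μ : ∀ p, E (pr p) × TangentSpace J p →ₗ[ℝ] ℝ)
    (Z Z' : ∀ p, E (pr p) × TangentSpace J p) (p : P) : ℝ :=
  dFun J pr (fun p ↦ μ p (Z' p)) Z p - dFun J pr (fun p ↦ μ p (Z p)) Z' p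
    - μ p (𝔄.prolongationBracket J pr Z Z' p)

end LieAlgebroid

end LieAlgebroid

/-! ## The Hamiltonian formalism on `ℝ^k × (E* ⊕ ⋯ ⊕ E*)` -/

section Hamiltonian

variable {k n m : ℕ} {Q : Type*} [TopologicalSpace Q]
  [ChartedSpace (EuclideanSpace ℝ (Fin n)) Q] [IsManifold (𝓡 n) ∞ Q]
  {E : Q → Type*} [∀ q, AddCommGroup (E q)] [∀ q, Module ℝ (E q)] [∀ q, TopologicalSpace (E q)]
  [∀ q, IsTopologicalAddGroup (E q)] [∀ q, ContinuousSMul ℝ (E q)]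
  [TopologicalSpace (TotalSpace (EuclideanSpace ℝ (Fin m)) E)]
  [FiberBundle (EuclideanSpace ℝ (Fin m)) E] [VectorBundle ℝ (EuclideanSpace ℝ (Fin m)) E]
  [ContMDiffVectorBundle ∞ (EuclideanSpace ℝ (Fin m)) E (𝓡 n)]

/-- The dual bundle `E*`. -/
abbrev DualBundle {Q : Type*} (E : Q → Type*) [∀ q, AddCommGroup (E q)] [∀ q, Module ℝ (E q)]
    [∀ q, TopologicalSpace (E q)] (q : Q) : Type _ :=
  E q →L[ℝ] Bundle.Trivial Q ℝ q

variable (k m E) in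
/-- The manifold `ℝ^k × (E* ⊕ ⋯ ⊕ E*)`. -/
abbrev HamPhase : Type _ :=
  EuclideanSpace ℝ (Fin k) ×
    TotalSpace (Fin k → EuclideanSpace ℝ (Fin m) →L[ℝ] ℝ) (WhitneySum k (DualBundle E))

variable (k n m) in
/-- The model with corners (without boundary) of `ℝ^k × (E* ⊕ ⋯ ⊕ E*)`. -/
abbrev hamModel :=
  (𝓡 k).prod ((𝓡 n).prod 𝓘(ℝ, Fin k → EuclideanSpace ℝ (Fin m) →L[ℝ] ℝ))

/-- `∂f/∂t^A` for a function `f` on an open subset of `ℝ^k`. -/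
def partialT (A : Fin k) (f : EuclideanSpace ℝ (Fin k) → ℝ) (t : EuclideanSpace ℝ (Fin k)) :
    ℝ :=
  fderiv ℝ f t (EuclideanSpace.single A 1)

namespace HamPhase

/-- The projection `ℝ^k × (E* ⊕ ⋯ ⊕ E*) → Q`. -/
def proj (p : HamPhase k m E) : Q := p.2.proj

/-- The `A`-th covector `e*_A` of the point `(t, e*_1, …, e*_k)`. -/
def covector (p : HamPhase k m E) (A : Fin k) : E p.proj →L[ℝ] ℝ := p.2.2 A

variable (k n m E) in
/-- A (not necessarily smooth) field of pairs `(a, v) ∈ E × T(ℝ^k × (E* ⊕ ⋯ ⊕ E*))`. -/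
abbrev PairField : Type _ :=
  ∀ p : HamPhase k m E, E p.proj × TangentSpace (hamModel k n m) p

/-- The Liouville `1`-section `Θ^A(a, v) = e*_A(a)`. -/
def liouville (A : Fin k) (p : HamPhase k m E) :
    E p.proj × TangentSpace (hamModel k n m) p →ₗ[ℝ] ℝ :=
  (p.covector A).toLinearMap.comp (LinearMap.fst ℝ _ _)

/-- The Liouville `2`-section `Ω^A = - d Θ^A`. -/
def liouvilleTwo (𝔄 : LieAlgebroid n m E) (A : Fin k) (Z Z' : PairField k n m E)
    (p : HamPhase k m E) : ℝ :=
  -𝔄.dOne (hamModel k n m) proj (liouville A) Z Z' p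

/-- The `1`-section `𝒴^B(a, v) = v(t^B)`. -/
def dtSection (B : Fin k) (p : HamPhase k m E)
    (z : E p.proj × TangentSpace (hamModel k n m) p) : ℝ :=
  dirDeriv (hamModel k n m) (fun p : HamPhase k m E ↦ p.1 B) p z.2

/-- `k` sections `ξ_1, …, ξ_k` of the Hamiltonian prolongation that satisfy `𝒴^B(ξ_A) = δ^B_A` and
`∑_A i_{ξ_A} Ω^A = d H - ∑_A (∂H/∂t^A) 𝒴^A`; the last equation, between `1`-sections, is tested on
smooth sections over open sets. -/
structure IsHamiltonianSection (𝔄 : LieAlgebroid n m E) (H : HamPhase k m E → ℝ)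
    (ξ : Fin k → PairField k n m E) : Prop where
  isSection : ∀ A, 𝔄.IsProlongationSection (hamModel k n m) proj (ξ A) univ
  dt_eq : ∀ A B p, dtSection B p (ξ A p) = if A = B then 1 else 0
  geometric_eq : ∀ (W : Set (HamPhase k m E)), IsOpen W → ∀ Z : PairField k n m E,
    𝔄.IsProlongationSection (hamModel k n m) proj Z W → ∀ p ∈ W,
      ∑ A, liouvilleTwo 𝔄 A (ξ A) Z p =
        LieAlgebroid.dFun (hamModel k n m) proj H Z p -
          ∑ A, partialT A (fun t ↦ H (t, p.2)) p.1 * dtSection A p (Z p)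

/-- `ψ`, defined on the open set `W ⊆ ℝ^k`, is an integral section of `(ξ_1, …, ξ_k)`:
`ψ_*(∂/∂t^A) = ρ(ξ_A) ∘ ψ`, where the anchor `ρ` is `(a, v) ↦ v`. -/
structure IsIntegralSection (ξ : Fin k → PairField k n m E) (W : Set (EuclideanSpace ℝ (Fin k)))
    (ψ : EuclideanSpace ℝ (Fin k) → HamPhase k m E) : Prop where
  isOpen : IsOpen W
  mdifferentiableAt : ∀ t ∈ W, MDifferentiableAt (𝓡 k) (hamModel k n m) ψ t
  mfderiv_eq : ∀ t ∈ W, ∀ A,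
    mfderiv (𝓡 k) (hamModel k n m) ψ t (EuclideanSpace.single A (1 : ℝ)) = (ξ A (ψ t)).2

/-! ### Local coordinates `(t^A, q^i, y^A_α)` -/

section Coordinates

variable (φ : OpenPartialHomeomorph Q (EuclideanSpace ℝ (Fin n))) {e : Fin m → ∀ q, E q}
  {U : Set Q} (he : IsLocalFrameOn (𝓡 n) (EuclideanSpace ℝ (Fin m)) ∞ e U)

/-- The dual frame `e^α` of a local frame `e_α`. -/
def dualFrame (α : Fin m) (q : Q) : E q →L[ℝ] ℝ :=
  (LinearMap.toContinuousLinearMap ((he.coeff α q).comp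
    (VectorBundle.continuousLinearEquivAt ℝ (EuclideanSpace ℝ (Fin m)) E q).symm.toLinearMap)).comp
  (VectorBundle.continuousLinearEquivAt ℝ (EuclideanSpace ℝ (Fin m)) E q).toContinuousLinearMap

set_option linter.unusedSectionVars false in
theorem dualFrame_apply (α : Fin m) (q : Q) (a : E q) : dualFrame he α q a = he.coeff α q a := by
  change he.coeff α q ((VectorBundle.continuousLinearEquivAt ℝ (EuclideanSpace ℝ (Fin m)) E q).symm
    (VectorBundle.continuousLinearEquivAt ℝ (EuclideanSpace ℝ (Fin m)) E q a)) = _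
  rw [ContinuousLinearEquiv.symm_apply_apply]

/-- The coordinates `(t^A, q^i, y^A_α)` of a point, with `y^A_α = e*_A(e_α)`. -/
def coords (e : Fin m → ∀ q, E q) (p : HamPhase k m E) :
    EuclideanSpace ℝ (Fin k) × EuclideanSpace ℝ (Fin n) × (Fin k → Fin m → ℝ) :=
  (p.1, φ p.proj, fun A α ↦ p.covector A (e α p.proj))

/-- The point with coordinates `(t^A, q^i, y^A_α)`. -/
def ofCoords (c : EuclideanSpace ℝ (Fin k) × EuclideanSpace ℝ (Fin n) × (Fin k → Fin m → ℝ)) :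
    HamPhase k m E :=
  (c.1, ⟨φ.symm c.2.1, fun A ↦ ∑ α, c.2.2 A α • dualFrame he α (φ.symm c.2.1)⟩)

theorem coords_ofCoords
    (c : EuclideanSpace ℝ (Fin k) × EuclideanSpace ℝ (Fin n) × (Fin k → Fin m → ℝ))
    (h₁ : c.2.1 ∈ φ.target) (h₂ : φ.symm c.2.1 ∈ U) : coords φ e (ofCoords φ he c) = c := by
  obtain ⟨t, x, y⟩ := c
  refine Prod.ext rfl (Prod.ext (φ.right_inv h₁) ?_)
  funext A β
  change (∑ α, y A α • dualFrame he α (φ.symm x)) (e β (φ.symm x)) = y A β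
  have h : ∀ α, he.coeff α (φ.symm x) (e β (φ.symm x)) = if β = α then 1 else 0 := by
    intro α
    rw [he.coeff_apply_of_mem h₂ (e β), ← he.toBasisAt_coe h₂ β, Module.Basis.repr_self,
      Finsupp.single_apply]
  simp [dualFrame_apply, h]

/-- `∂H/∂q^i` at the point `p`. -/
def partialQ (H : HamPhase k m E → ℝ) (i : Fin n) (p : HamPhase k m E) : ℝ :=
  fderiv ℝ (fun c ↦ H (ofCoords φ he c)) (coords φ e p) (0, EuclideanSpace.single i 1, 0)

/-- `∂H/∂y^A_α` at the point `p`. -/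
def partialY (H : HamPhase k m E → ℝ) (A : Fin k) (α : Fin m) (p : HamPhase k m E) : ℝ :=
  fderiv ℝ (fun c ↦ H (ofCoords φ he c)) (coords φ e p) (0, 0, Pi.single A (Pi.single α 1))

end Coordinates

end HamPhase

end Hamiltonian

end

/-! The heart of the proof is a pointwise formula for `Ω^A`. Let `Z = (a, v)` and `Z' = (b, w)` be
sections of the prolongation, let `e_μ` be a local frame of `E`, and let `y_μ = e*_A(e_μ)`. Then
`Θ^A(Z) = y_μ a^μ`. In `-dΘ^A(Z, Z')` the derivatives of the components `a^μ`, `b^ν` cancel against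
those in the bracket `⟦Z, Z'⟧`, which leaves `a^μ w(y_μ) - b^ν v(y_ν) + y_λ 𝒞^λ_{μν} a^μ b^ν`, the
quantity `frameTwoForm`.

The bracket is defined through the frame of the preferred trivialization, while the equations are
claimed in an arbitrary frame, so the formula must be shown to be independent of the frame. A
transition matrix `M` contributes derivatives `v(M ∘ pr)` through the `y_μ` and derivatives `ρ(a) M`
through the Leibniz rule of `E`. They cancel because `T pr (v) = ρ(a)`, the condition that defines
the prolongation (`frameTwoForm_eq_frameTwoForm`). The local brackets used here make sense because
bump functions show that the bracket of `E` depends only on germs.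

The Hamiltonian equation is then tested on two kinds of sections without `∂/∂t` component. The
vertical section `(0, ∂/∂y^A_α)` isolates one component and gives `ξ_A^α = ∂H/∂y^A_α`
(`coeff_eq_partialY`). The section over `e_β` whose vector has `q`-components `ρ(e_β)` and no
`y`-components gives the sum of the derivatives of `y^A_β` along `ξ_A` (`sum_dirDeriv_covector`).
Along an integral section, the derivative of a function in the direction `ξ_A` is `∂/∂t^A` of its
composition with `ψ`. Finally, the prolongation condition turns `ξ_A(q^i)` into `ρ^i_α ξ_A^α`. -/

/-! ### Calculus of derivatives along a tangent vector. -/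

section DirDeriv

variable {EP HP P : Type*} [NormedAddCommGroup EP] [NormedSpace ℝ EP] [TopologicalSpace HP]
  {J : ModelWithCorners ℝ EP HP} [TopologicalSpace P] [ChartedSpace HP P]
  {f g : P → ℝ} {p : P} {v w : TangentSpace J p}

theorem dirDeriv_congr (h : f =ᶠ[𝓝 p] g) : dirDeriv J f p v = dirDeriv J g p v := by
  unfold dirDeriv
  rw [h.mfderiv_eq]
  rfl

theorem dirDeriv_smul_vec (c : ℝ) : dirDeriv J f p (c • v) = c * dirDeriv J f p v :=
  (mfderiv J 𝓘(ℝ) f p).map_smul c v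

theorem dirDeriv_sum_vec {ι : Type*} (s : Finset ι) (v : ι → TangentSpace J p) :
    dirDeriv J f p (∑ i ∈ s, v i) = ∑ i ∈ s, dirDeriv J f p (v i) :=
  map_sum (mfderiv J 𝓘(ℝ) f p) v s

theorem dirDeriv_mul (hf : MDifferentiableAt J 𝓘(ℝ) f p) (hg : MDifferentiableAt J 𝓘(ℝ) g p) :
    dirDeriv J (fun x ↦ f x * g x) p v = dirDeriv J f p v * g p + f p * dirDeriv J g p v := by
  have h := (hf.hasMFDerivAt.mul hg.hasMFDerivAt).mfderiv
  unfold dirDeriv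
  change mfderiv J 𝓘(ℝ) (f * g) p v = _
  rw [h]
  change f p * dirDeriv J g p v + g p * dirDeriv J f p v =
    dirDeriv J f p v * g p + f p * dirDeriv J g p v
  ring

theorem dirDeriv_sum {ι : Type} (s : Finset ι) {f : ι → P → ℝ}
    (hf : ∀ i ∈ s, MDifferentiableAt J 𝓘(ℝ) (f i) p) :
    dirDeriv J (fun x ↦ ∑ i ∈ s, f i x) p v = ∑ i ∈ s, dirDeriv J (f i) p v := by
  have h := (HasMFDerivAt.sum (f := f) (f' := fun i ↦ mfderiv J 𝓘(ℝ) (f i) p)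
    fun i hi ↦ (hf i hi).hasMFDerivAt).mfderiv
  have h' : (fun x ↦ ∑ i ∈ s, f i x) = ∑ i ∈ s, f i := by
    funext x
    simp
  unfold dirDeriv
  rw [h', h]
  have key : ∀ L : ι → (TangentSpace J p →L[ℝ] ℝ), (∑ i ∈ s, L i) v = ∑ i ∈ s, L i v :=
    fun L ↦ by simp
  exact key fun i ↦ mfderiv J 𝓘(ℝ) (f i) p

theorem dirDeriv_comp {EQ HQ Q : Type*} [NormedAddCommGroup EQ] [NormedSpace ℝ EQ]
    [TopologicalSpace HQ] {K : ModelWithCorners ℝ EQ HQ} [TopologicalSpace Q] [ChartedSpace HQ Q]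
    {F : P → Q} {f : Q → ℝ} (hf : MDifferentiableAt K 𝓘(ℝ) f (F p))
    (hF : MDifferentiableAt J K F p) :
    dirDeriv J (fun x ↦ f (F x)) p v = dirDeriv K f (F p) (mfderiv J K F p v) := by
  have h := mfderiv_comp p hf hF
  unfold dirDeriv
  change mfderiv J 𝓘(ℝ) (f ∘ F) p v = _
  rw [h]
  rfl

theorem dirDeriv_clm_comp {G : Type*} [NormedAddCommGroup G] [NormedSpace ℝ G] (L : G →L[ℝ] ℝ)
    {F : P → G} (hF : MDifferentiableAt J 𝓘(ℝ, G) F p) :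
    dirDeriv J (fun x ↦ L (F x)) p v = L (mfderiv J 𝓘(ℝ, G) F p v) := by
  rw [dirDeriv_comp (K := 𝓘(ℝ, G)) (f := fun x ↦ L x) (F := F)
    L.differentiableAt.mdifferentiableAt hF]
  unfold dirDeriv
  rw [mfderiv_eq_fderiv, L.fderiv]
  rfl

end DirDeriv

/-! ### Locality of the algebroid bracket and its expansion in a frame. -/

section BumpExtension

variable {n m : ℕ} {Q : Type*} [TopologicalSpace Q]
  [ChartedSpace (EuclideanSpace ℝ (Fin n)) Q] [IsManifold (𝓡 n) ∞ Q]
  {E : Q → Type*} [∀ q, AddCommGroup (E q)] [∀ q, Module ℝ (E q)] [∀ q, TopologicalSpace (E q)]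
  [TopologicalSpace (TotalSpace (EuclideanSpace ℝ (Fin m)) E)]
  [FiberBundle (EuclideanSpace ℝ (Fin m)) E] [VectorBundle ℝ (EuclideanSpace ℝ (Fin m)) E]

namespace LieAlgebroid

variable (𝔄 : LieAlgebroid n m E)

theorem bracket_skew (σ τ : Sec n m E) : 𝔄.bracket σ τ = -𝔄.bracket τ σ := by
  have h := 𝔄.bracket_self (σ + τ)
  simp only [map_add, LinearMap.add_apply, 𝔄.bracket_self, zero_add, add_zero] at h
  exact eq_neg_of_add_eq_zero_right h

theorem leibniz_left {f : Q → ℝ} (hf : ContMDiff (𝓡 n) 𝓘(ℝ) ∞ f) (σ τ : Sec n m E) (q : Q) :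
    𝔄.bracket ⟨f • ⇑σ, hf.smul_section σ.contMDiff⟩ τ q =
      f q • 𝔄.bracket σ τ q - dirDeriv (𝓡 n) f q (𝔄.anchor q (τ q)) • σ q := by
  rw [𝔄.bracket_skew, ContMDiffSection.coe_neg, Pi.neg_apply, 𝔄.leibniz f hf τ σ q,
    𝔄.bracket_skew τ σ, ContMDiffSection.coe_neg, Pi.neg_apply]
  module

/-- Expanding bilinearly and applying the Leibniz rule in both arguments gives two double sums of
derivative terms. Linearity of the anchor collapses each to a single sum. -/
theorem bracket_sum_smul {ι : Type*} [Fintype ι] (u : ι → Sec n m E) {f g : ι → Q → ℝ}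
    (hf : ∀ i, ContMDiff (𝓡 n) 𝓘(ℝ) ∞ (f i)) (hg : ∀ i, ContMDiff (𝓡 n) 𝓘(ℝ) ∞ (g i)) (q : Q) :
    𝔄.bracket (∑ i, ⟨f i • ⇑(u i), (hf i).smul_section (u i).contMDiff⟩)
        (∑ i, ⟨g i • ⇑(u i), (hg i).smul_section (u i).contMDiff⟩) q =
      ∑ j, (dirDeriv (𝓡 n) (g j) q (𝔄.anchor q (∑ i, f i q • u i q)) -
          dirDeriv (𝓡 n) (f j) q (𝔄.anchor q (∑ i, g i q • u i q))) • u j q +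
        ∑ i, ∑ j, (f i q * g j q) • 𝔄.bracket (u i) (u j) q := by
  have hcoe : ∀ (t : ι → Sec n m E), (∑ i, t i) q = ∑ i, t i q := fun t ↦ by
    change ContMDiffSection.coeAddHom _ _ _ _ (∑ i, t i) q = _
    rw [map_sum, Finset.sum_apply]
    rfl
  have hterm : ∀ i j, 𝔄.bracket ⟨f i • ⇑(u i), (hf i).smul_section (u i).contMDiff⟩
      ⟨g j • ⇑(u j), (hg j).smul_section (u j).contMDiff⟩ q =
      (f i q * g j q) • 𝔄.bracket (u i) (u j) q +
        (f i q * dirDeriv (𝓡 n) (g j) q (𝔄.anchor q (u i q))) • u j q -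
        (g j q * dirDeriv (𝓡 n) (f i) q (𝔄.anchor q (u j q))) • u i q := by
    intro i j
    rw [𝔄.leibniz_left (hf i), 𝔄.leibniz (g j) (hg j)]
    change _ - dirDeriv (𝓡 n) (f i) q (𝔄.anchor q (g j q • u j q)) • u i q = _
    rw [map_smul, dirDeriv_smul_vec]
    module
  rw [map_sum 𝔄.bracket, LinearMap.sum_apply, hcoe]
  simp_rw [map_sum, hcoe, hterm, map_smul, dirDeriv_sum_vec, dirDeriv_smul_vec,
    Finset.sum_sub_distrib, Finset.sum_add_distrib, sub_smul, Finset.sum_smul,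
    Finset.sum_sub_distrib]
  -- Only the sum with derivatives of `g` has its summation order the wrong way round for collecting
  -- the coefficient of each `u j`.
  rw [Finset.sum_comm (f := fun i j ↦ (f i q * dirDeriv (𝓡 n) (g j) q (𝔄.anchor q (u i q))) • u j q)]
  abel

end LieAlgebroid

variable [T2Space Q]

/-- The Hausdorff assumption enters here: it makes the support of a chart-based bump function closed
in all of `Q`, so that local data extend by zero. -/
theorem exists_contMDiff_bump {q : Q} {U : Set Q} (hU : U ∈ 𝓝 q) :
    ∃ f : Q → ℝ, ContMDiff (𝓡 n) 𝓘(ℝ) ∞ f ∧ f =ᶠ[𝓝 q] 1 ∧ tsupport f ⊆ U := by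
  obtain ⟨f, -, hf⟩ := (SmoothBumpFunction.nhds_basis_tsupport (I := 𝓡 n) q).mem_iff.1 hU
  exact ⟨f, f.contMDiff, f.eventuallyEq_one, hf⟩

theorem exists_sec_eventuallyEq {q : Q} {U : Set Q} (hU : IsOpen U) (hq : q ∈ U)
    {s : ∀ q, E q}
    (hs : ContMDiffOn (𝓡 n) ((𝓡 n).prod 𝓘(ℝ, EuclideanSpace ℝ (Fin m))) ∞
      (fun x ↦ TotalSpace.mk' (EuclideanSpace ℝ (Fin m)) x (s x)) U) :
    ∃ σ : Sec n m E, ∀ᶠ x in 𝓝 q, σ x = s x := by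
  obtain ⟨f, hf, hf1, hfU⟩ := exists_contMDiff_bump (n := n) (hU.mem_nhds hq)
  refine ⟨⟨f • s, ContMDiffOn.smul_section_of_tsupport hf.contMDiffOn hU hfU hs⟩, ?_⟩
  filter_upwards [hf1] with x hx
  change f x • s x = s x
  rw [hx]
  exact one_smul _ _

theorem exists_contMDiff_eventuallyEq {q : Q} {U : Set Q} (hU : IsOpen U) (hq : q ∈ U)
    {g : Q → ℝ} (hg : ContMDiffOn (𝓡 n) 𝓘(ℝ) ∞ g U) :
    ∃ g' : Q → ℝ, ContMDiff (𝓡 n) 𝓘(ℝ) ∞ g' ∧ g' =ᶠ[𝓝 q] g := by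
  obtain ⟨f, hf, hf1, hfU⟩ := exists_contMDiff_bump (n := n) (hU.mem_nhds hq)
  refine ⟨fun x ↦ f x • g x, contMDiff_of_tsupport fun x hx ↦ ?_, ?_⟩
  · have hx' : x ∈ U := hfU (closure_mono (fun y hy ↦ by
      rw [Function.mem_support] at hy ⊢
      exact fun h0 ↦ hy (by simp [h0])) hx)
    exact hf.contMDiffAt.smul (hg.contMDiffAt (hU.mem_nhds hx'))
  · filter_upwards [hf1] with x hx
    simp [hx]

namespace LieAlgebroid

variable (𝔄 : LieAlgebroid n m E)

/-- For a bump function `f` supported where `τ` vanishes, `f τ = 0`. At `q` one has `f = 1` and `τ =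
0`, so the Leibniz rule reads `0 = ⟦σ, τ⟧(q)`. -/
theorem bracket_eq_zero_of_eventuallyEq {σ τ : Sec n m E} {q : Q}
    (h : ∀ᶠ x in 𝓝 q, τ x = 0) : 𝔄.bracket σ τ q = 0 := by
  obtain ⟨f, hf, hf1, hfU⟩ := exists_contMDiff_bump (n := n) h
  have h0 : (⟨f • ⇑τ, hf.smul_section τ.contMDiff⟩ : Sec n m E) = 0 := by
    ext x
    change f x • τ x = 0
    by_cases hx : x ∈ tsupport f
    · rw [show τ x = 0 from hfU hx, smul_zero]
    · rw [image_eq_zero_of_notMem_tsupport hx, zero_smul]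
  have hL := 𝔄.leibniz f hf σ τ q
  rw [h0, map_zero, h.self_of_nhds, smul_zero, add_zero, hf1.self_of_nhds] at hL
  simpa using hL.symm

theorem bracket_congr {σ σ' τ τ' : Sec n m E} {q : Q} (hσ : ∀ᶠ x in 𝓝 q, σ x = σ' x)
    (hτ : ∀ᶠ x in 𝓝 q, τ x = τ' x) : 𝔄.bracket σ τ q = 𝔄.bracket σ' τ' q := by
  have h1 : 𝔄.bracket σ (τ - τ') q = 0 := by
    refine 𝔄.bracket_eq_zero_of_eventuallyEq (hτ.mono fun x hx ↦ ?_)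
    simp [hx]
  have h2 : 𝔄.bracket τ' (σ - σ') q = 0 := by
    refine 𝔄.bracket_eq_zero_of_eventuallyEq (hσ.mono fun x hx ↦ ?_)
    simp [hx]
  rw [map_sub, ContMDiffSection.coe_sub, Pi.sub_apply, sub_eq_zero] at h1 h2
  rw [h1, 𝔄.bracket_skew σ, 𝔄.bracket_skew σ', ContMDiffSection.coe_neg, Pi.neg_apply, h2]
  rfl

/-- The arbitrary choice of extensions in `localBracket` is harmless, since two extensions have the
same germs. -/
theorem localBracket_eq {s s' : ∀ q, E q} {q : Q} {σ τ : Sec n m E}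
    (hσ : ∀ᶠ x in 𝓝 q, σ x = s x) (hτ : ∀ᶠ x in 𝓝 q, τ x = s' x) :
    𝔄.localBracket s s' q = 𝔄.bracket σ τ q := by
  have h : ∃ σ : Sec n m E × Sec n m E,
      (∀ᶠ x in 𝓝 q, σ.1 x = s x) ∧ ∀ᶠ x in 𝓝 q, σ.2 x = s' x := ⟨(σ, τ), hσ, hτ⟩
  rw [localBracket, dif_pos h]
  refine 𝔄.bracket_congr ?_ ?_
  · filter_upwards [h.choose_spec.1, hσ] with x h1 h2
    rw [h1, h2]
  · filter_upwards [h.choose_spec.2, hτ] with x h1 h2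
    rw [h1, h2]

theorem localBracket_congr {s₁ s₂ s₁' s₂' : ∀ q, E q} {q : Q} (h : ∀ᶠ x in 𝓝 q, s₁ x = s₂ x)
    (h' : ∀ᶠ x in 𝓝 q, s₁' x = s₂' x) :
    𝔄.localBracket s₁ s₁' q = 𝔄.localBracket s₂ s₂' q := by
  by_cases hex : ∃ σ : Sec n m E × Sec n m E,
      (∀ᶠ x in 𝓝 q, σ.1 x = s₁ x) ∧ ∀ᶠ x in 𝓝 q, σ.2 x = s₁' x
  · obtain ⟨σ, h1, h2⟩ := hex
    rw [𝔄.localBracket_eq h1 h2, 𝔄.localBracket_eq (s := s₂) (s' := s₂') (σ := σ.1) (τ := σ.2)]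
    · filter_upwards [h, h1] with x a b using b.trans a
    · filter_upwards [h', h2] with x a b using b.trans a
  -- Germs without global smooth extensions give the default value `0` on both sides.
  · have hex' : ¬ ∃ σ : Sec n m E × Sec n m E,
        (∀ᶠ x in 𝓝 q, σ.1 x = s₂ x) ∧ ∀ᶠ x in 𝓝 q, σ.2 x = s₂' x := by
      rintro ⟨σ, h1, h2⟩
      refine hex ⟨σ, ?_, ?_⟩
      · filter_upwards [h, h1] with x a b using b.trans a.symm
      · filter_upwards [h', h2] with x a b using b.trans a.symm
    rw [localBracket, localBracket, dif_neg hex, dif_neg hex']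

theorem localBracket_skew (s s' : ∀ q, E q) (q : Q) :
    𝔄.localBracket s s' q = -𝔄.localBracket s' s q := by
  by_cases hex : ∃ σ : Sec n m E × Sec n m E,
      (∀ᶠ x in 𝓝 q, σ.1 x = s x) ∧ ∀ᶠ x in 𝓝 q, σ.2 x = s' x
  · obtain ⟨σ, h1, h2⟩ := hex
    rw [𝔄.localBracket_eq h1 h2, 𝔄.localBracket_eq h2 h1, 𝔄.bracket_skew]
    rfl
  · have hex' : ¬ ∃ σ : Sec n m E × Sec n m E,
        (∀ᶠ x in 𝓝 q, σ.1 x = s' x) ∧ ∀ᶠ x in 𝓝 q, σ.2 x = s x := by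
      rintro ⟨σ, h1, h2⟩
      exact hex ⟨σ.swap, h2, h1⟩
    rw [localBracket, localBracket, dif_neg hex, dif_neg hex', neg_zero]

/-- Sections and coefficients are replaced by global ones with the same germs, which changes no
value or derivative at `q`. The global expansion then applies. -/
theorem localBracket_sum_smul {ι : Type*} [Fintype ι] {q : Q} {U : Set Q} (hU : IsOpen U)
    (hq : q ∈ U) {u : ι → ∀ q, E q}
    (hu : ∀ i, ContMDiffOn (𝓡 n) ((𝓡 n).prod 𝓘(ℝ, EuclideanSpace ℝ (Fin m))) ∞
      (fun x ↦ TotalSpace.mk' (EuclideanSpace ℝ (Fin m)) x (u i x)) U)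
    {f g : ι → Q → ℝ} (hf : ∀ i, ContMDiffOn (𝓡 n) 𝓘(ℝ) ∞ (f i) U)
    (hg : ∀ i, ContMDiffOn (𝓡 n) 𝓘(ℝ) ∞ (g i) U) :
    𝔄.localBracket (fun x ↦ ∑ i, f i x • u i x) (fun x ↦ ∑ i, g i x • u i x) q =
      ∑ j, (dirDeriv (𝓡 n) (g j) q (𝔄.anchor q (∑ i, f i q • u i q)) -
          dirDeriv (𝓡 n) (f j) q (𝔄.anchor q (∑ i, g i q • u i q))) • u j q +
        ∑ i, ∑ j, (f i q * g j q) • 𝔄.localBracket (u i) (u j) q := by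
  choose u' hu' using fun i ↦ exists_sec_eventuallyEq hU hq (hu i)
  choose f' hf's hf' using fun i ↦ exists_contMDiff_eventuallyEq hU hq (hf i)
  choose g' hg's hg' using fun i ↦ exists_contMDiff_eventuallyEq hU hq (hg i)
  have hcoe : ∀ (t : ι → Sec n m E) (x : Q), (∑ i, t i) x = ∑ i, t i x := fun t x ↦ by
    change ContMDiffSection.coeAddHom _ _ _ _ (∑ i, t i) x = _
    rw [map_sum, Finset.sum_apply]
    rfl
  have key : ∀ {h h' : ι → Q → ℝ} (hs : ∀ i, ContMDiff (𝓡 n) 𝓘(ℝ) ∞ (h' i)),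
      (∀ i, h' i =ᶠ[𝓝 q] h i) → ∀ᶠ x in 𝓝 q,
      (∑ i, (⟨h' i • ⇑(u' i), (hs i).smul_section (u' i).contMDiff⟩ : Sec n m E)) x =
        ∑ i, h i x • u i x := by
    intro h h' hs hh
    filter_upwards [eventually_all.2 hu', eventually_all.2 hh] with x h1 h2
    rw [hcoe]
    refine Finset.sum_congr rfl fun i _ ↦ ?_
    change h' i x • u' i x = _
    rw [h1, h2]
  rw [𝔄.localBracket_eq (key hf's hf') (key hg's hg'), 𝔄.bracket_sum_smul u' hf's hg's q]
  have e1 : ∀ i, u' i q = u i q := fun i ↦ (hu' i).self_of_nhds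
  have e2 : ∀ i, f' i q = f i q := fun i ↦ (hf' i).self_of_nhds
  have e3 : ∀ i, g' i q = g i q := fun i ↦ (hg' i).self_of_nhds
  have e4 : ∀ i v, dirDeriv (𝓡 n) (f' i) q v = dirDeriv (𝓡 n) (f i) q v :=
    fun i v ↦ dirDeriv_congr (hf' i)
  have e5 : ∀ i v, dirDeriv (𝓡 n) (g' i) q v = dirDeriv (𝓡 n) (g i) q v :=
    fun i v ↦ dirDeriv_congr (hg' i)
  have e6 : ∀ i j, 𝔄.localBracket (u i) (u j) q = 𝔄.bracket (u' i) (u' j) q :=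
    fun i j ↦ 𝔄.localBracket_eq (hu' i) (hu' j)
  simp only [e1, e2, e3, e4, e5, e6]

end LieAlgebroid

end BumpExtension

/-! ### Smooth maps into a Whitney sum. -/

namespace WhitneySum

variable {k : ℕ} {B : Type*} [TopologicalSpace B] {E : B → Type*}
  {F : Type*} [NormedAddCommGroup F] [NormedSpace ℝ F]
  [∀ x, AddCommGroup (E x)] [∀ x, Module ℝ (E x)]
  [TopologicalSpace (TotalSpace F E)] [∀ x, TopologicalSpace (E x)] [FiberBundle F E]
  [VectorBundle ℝ F E]
  {EB : Type*} [NormedAddCommGroup EB] [NormedSpace ℝ EB] {HB : Type*} [TopologicalSpace HB]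
  {IB : ModelWithCorners ℝ EB HB} [ChartedSpace HB B]
  {EM : Type*} [NormedAddCommGroup EM] [NormedSpace ℝ EM] {HM : Type*} [TopologicalSpace HM]
  {IM : ModelWithCorners ℝ EM HM} {M : Type*} [TopologicalSpace M] [ChartedSpace HM M]

theorem trivializationAt_apply (q x : B) (hx : x ∈ (trivializationAt F E q).baseSet)
    (v : WhitneySum k E x) :
    (trivializationAt (Fin k → F) (WhitneySum k E) q ⟨x, v⟩).2 =
      fun A ↦ (trivializationAt F E q ⟨x, v A⟩).2 := by
  funext A
  change (trivializationAt F E q).linearMapAt ℝ x (v A) = _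
  rw [(trivializationAt F E q).coe_linearMapAt_of_mem hx]

/-- The trivialization of the Whitney sum acts componentwise, and continuity of `b` keeps nearby
base points inside its domain. -/
theorem contMDiffAt_iff {N : ℕ∞ω} {b : M → B} {v : ∀ x, WhitneySum k E (b x)} {x₀ : M} :
    ContMDiffAt IM (IB.prod 𝓘(ℝ, Fin k → F)) N
        (fun x ↦ (⟨b x, v x⟩ : TotalSpace (Fin k → F) (WhitneySum k E))) x₀ ↔
      ContMDiffAt IM IB N b x₀ ∧ ∀ A, ContMDiffAt IM (IB.prod 𝓘(ℝ, F)) N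
        (fun x ↦ (⟨b x, v x A⟩ : TotalSpace F E)) x₀ := by
  have key : ContMDiffAt IM IB N b x₀ →
      (fun x ↦ (trivializationAt (Fin k → F) (WhitneySum k E) (b x₀) ⟨b x, v x⟩).2) =ᶠ[𝓝 x₀]
        fun x A ↦ (trivializationAt F E (b x₀) ⟨b x, v x A⟩).2 := by
    intro hb
    filter_upwards [hb.continuousAt.preimage_mem_nhds
      ((trivializationAt F E (b x₀)).open_baseSet.mem_nhds
        (FiberBundle.mem_baseSet_trivializationAt F E (b x₀)))] with x hx
    exact trivializationAt_apply _ _ hx _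
  simp only [contMDiffAt_totalSpace]
  constructor
  · rintro ⟨hb, hv⟩
    have := contMDiffAt_pi_space.1 (hv.congr_of_eventuallyEq (key hb).symm)
    exact ⟨hb, fun A ↦ ⟨hb, this A⟩⟩
  · rintro ⟨hb, hv⟩
    exact ⟨hb, (contMDiffAt_pi_space.2 fun A ↦ (hv A).2).congr_of_eventuallyEq (key hb)⟩

end WhitneySum

/-! ### Smoothness of pairings, dual frames and frame coefficients. -/

section Pairing

variable {k n m : ℕ} {Q : Type*} [TopologicalSpace Q]
  [ChartedSpace (EuclideanSpace ℝ (Fin n)) Q]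
  {E : Q → Type*} [∀ q, AddCommGroup (E q)] [∀ q, Module ℝ (E q)] [∀ q, TopologicalSpace (E q)]
  [TopologicalSpace (TotalSpace (EuclideanSpace ℝ (Fin m)) E)]
  [FiberBundle (EuclideanSpace ℝ (Fin m)) E] [VectorBundle ℝ (EuclideanSpace ℝ (Fin m)) E]
  {EM : Type*} [NormedAddCommGroup EM] [NormedSpace ℝ EM] {HM : Type*} [TopologicalSpace HM]
  {IM : ModelWithCorners ℝ EM HM} {M : Type*} [TopologicalSpace M] [ChartedSpace HM M]

theorem ContMDiffAt.dual_apply {b : M → Q} {ϕ : ∀ x, DualBundle E (b x)} {v : ∀ x, E (b x)}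
    {x₀ : M}
    (hϕ : ContMDiffAt IM ((𝓡 n).prod 𝓘(ℝ, EuclideanSpace ℝ (Fin m) →L[ℝ] ℝ)) ∞
      (fun x ↦ (⟨b x, ϕ x⟩ : TotalSpace (EuclideanSpace ℝ (Fin m) →L[ℝ] ℝ) (DualBundle E))) x₀)
    (hv : ContMDiffAt IM ((𝓡 n).prod 𝓘(ℝ, EuclideanSpace ℝ (Fin m))) ∞
      (fun x ↦ (⟨b x, v x⟩ : TotalSpace (EuclideanSpace ℝ (Fin m)) E)) x₀) :
    ContMDiffAt IM 𝓘(ℝ) ∞ (fun x ↦ (ϕ x (v x) : ℝ)) x₀ :=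
  (contMDiffAt_totalSpace.1 (ContMDiffAt.clm_bundle_apply hϕ hv)).2

theorem HamPhase.contMDiff_proj :
    ContMDiff (hamModel k n m) (𝓡 n) ∞ (HamPhase.proj : HamPhase k m E → Q) :=
  (Bundle.contMDiff_proj (IB := 𝓡 n) (WhitneySum k (DualBundle E))).comp contMDiff_snd

theorem HamPhase.contMDiff_covector (A : Fin k) :
    ContMDiff (hamModel k n m) ((𝓡 n).prod 𝓘(ℝ, EuclideanSpace ℝ (Fin m) →L[ℝ] ℝ)) ∞
      (fun p : HamPhase k m E ↦
        (⟨p.proj, p.covector A⟩ : TotalSpace (EuclideanSpace ℝ (Fin m) →L[ℝ] ℝ) (DualBundle E))) :=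
  fun p ↦ (WhitneySum.contMDiffAt_iff.1 ((contMDiff_snd p :
    ContMDiffAt (hamModel k n m) _ ∞ (Prod.snd : HamPhase k m E → _) p))).2 A

theorem HamPhase.contMDiffAt_covector_apply (A : Fin k) {s : ∀ q, E q} {p : HamPhase k m E}
    (hs : ContMDiffAt (𝓡 n) ((𝓡 n).prod 𝓘(ℝ, EuclideanSpace ℝ (Fin m))) ∞
      (fun x ↦ (⟨x, s x⟩ : TotalSpace (EuclideanSpace ℝ (Fin m)) E)) p.proj) :
    ContMDiffAt (hamModel k n m) 𝓘(ℝ) ∞ (fun p ↦ p.covector A (s p.proj)) p :=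
  (HamPhase.contMDiff_covector A p).dual_apply (hs.comp p (HamPhase.contMDiff_proj p))

namespace IsLocalFrameOn

variable {e : Fin m → ∀ q, E q} {U : Set Q}
  (he : IsLocalFrameOn (𝓡 n) (EuclideanSpace ℝ (Fin m)) ∞ e U)

set_option linter.unusedSectionVars false in
theorem coeff_eq_ite {q : Q} (hq : q ∈ U) (α β : Fin m) :
    he.coeff α q (e β q) = if β = α then 1 else 0 := by
  rw [he.coeff_apply_of_mem hq (e β), ← he.toBasisAt_coe hq β, Module.Basis.repr_self,
    Finsupp.single_apply]

variable [IsManifold (𝓡 n) ∞ Q]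
  [∀ q, IsTopologicalAddGroup (E q)] [∀ q, ContinuousSMul ℝ (E q)]
  [ContMDiffVectorBundle ∞ (EuclideanSpace ℝ (Fin m)) E (𝓡 n)]

/-- In a trivialization the dual frame consists of the rows of the inverse of the matrix whose
columns are the frame vectors, and inversion of continuous linear maps is smooth at an invertible
one. -/
theorem contMDiffAt_dualFrame (hU : IsOpen U) {q : Q} (hq : q ∈ U) (α : Fin m) :
    ContMDiffAt (𝓡 n) ((𝓡 n).prod 𝓘(ℝ, EuclideanSpace ℝ (Fin m) →L[ℝ] ℝ)) ∞
      (fun x ↦ (⟨x, HamPhase.dualFrame he α x⟩ :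
        TotalSpace (EuclideanSpace ℝ (Fin m) →L[ℝ] ℝ) (DualBundle E))) q := by
  rw [contMDiffAt_hom_bundle]
  refine ⟨contMDiffAt_id, ?_⟩
  set T := trivializationAt (EuclideanSpace ℝ (Fin m)) E q with hT
  have hqT : q ∈ T.baseSet := FiberBundle.mem_baseSet_trivializationAt (EuclideanSpace ℝ (Fin m)) E q
  -- `L` assembles columns `f β` into the map `y ↦ ∑ β, y β • f β`. Being continuous linear in the
  -- columns, it makes the matrix `G` of the frame smooth.
  let L : (Fin m → EuclideanSpace ℝ (Fin m)) →L[ℝ] ((Fin m → ℝ) →L[ℝ] EuclideanSpace ℝ (Fin m)) :=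
    ∑ β, (ContinuousLinearMap.smulRightL ℝ (Fin m → ℝ) (EuclideanSpace ℝ (Fin m))
      (ContinuousLinearMap.proj (R := ℝ) (φ := fun _ : Fin m ↦ ℝ) β)).comp
        (ContinuousLinearMap.proj (R := ℝ) (φ := fun _ : Fin m ↦ EuclideanSpace ℝ (Fin m)) β)
  have hL : ∀ f y, L f y = ∑ β, y β • f β := by
    intro f y
    simp [L]
  let G : Q → ((Fin m → ℝ) →L[ℝ] EuclideanSpace ℝ (Fin m)) := fun x ↦ L fun β ↦ (T ⟨x, e β x⟩).2
  have hG : ContMDiffAt (𝓡 n) 𝓘(ℝ, (Fin m → ℝ) →L[ℝ] EuclideanSpace ℝ (Fin m)) ∞ G q := by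
    refine L.contMDiff.contMDiffAt.comp q (contMDiffAt_pi_space.2 fun β ↦ ?_)
    exact (contMDiffAt_totalSpace.1 (he.contMDiffAt hU hq β)).2
  have hequiv : ∀ x (hx : x ∈ U) (hx' : x ∈ T.baseSet), ∃ Φ : (Fin m → ℝ) ≃L[ℝ] EuclideanSpace ℝ (Fin m),
      G x = Φ ∧ ∀ v β, Φ.symm v β = he.coeff β x (T.symm x v) := by
    intro x hx hx'
    refine ⟨((he.toBasisAt hx).equivFun.symm.trans
      (T.linearEquivAt ℝ x hx')).toContinuousLinearEquiv, ?_, fun v β ↦ ?_⟩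
    · ext1 y
      rw [hL]
      change _ = T.linearEquivAt ℝ x hx' ((he.toBasisAt hx).equivFun.symm y)
      rw [Module.Basis.equivFun_symm_apply, map_sum]
      refine Finset.sum_congr rfl fun β _ ↦ ?_
      rw [map_smul, he.toBasisAt_coe hx]
      rfl
    · change (he.toBasisAt hx).equivFun ((T.linearEquivAt ℝ x hx').symm v) β = _
      simp [IsLocalFrameOn.coeff, hx]
  obtain ⟨Φ, hΦ, -⟩ := hequiv q hq hqT
  have hinv : ContMDiffAt (𝓡 n) 𝓘(ℝ, EuclideanSpace ℝ (Fin m) →L[ℝ] (Fin m → ℝ)) ∞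
      (fun x ↦ ContinuousLinearMap.inverse (G x)) q := by
    have h : ContDiffAt ℝ ∞ (ContinuousLinearMap.inverse : _ → EuclideanSpace ℝ (Fin m) →L[ℝ] (Fin m → ℝ)) (G q) := by
      rw [hΦ]
      exact contDiffAt_map_inverse Φ
    exact h.contMDiffAt.comp q hG
  let R : (EuclideanSpace ℝ (Fin m) →L[ℝ] (Fin m → ℝ)) →L[ℝ] (EuclideanSpace ℝ (Fin m) →L[ℝ] ℝ) :=
    ContinuousLinearMap.compL ℝ (EuclideanSpace ℝ (Fin m)) (Fin m → ℝ) ℝ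
      (ContinuousLinearMap.proj (R := ℝ) (φ := fun _ : Fin m ↦ ℝ) α)
  refine (R.contMDiff.contMDiffAt.comp q hinv).congr_of_eventuallyEq ?_
  filter_upwards [hU.mem_nhds hq, T.open_baseSet.mem_nhds hqT] with x hx hx'
  obtain ⟨Φ, hΦ, hΦ'⟩ := hequiv x hx hx'
  ext1 v
  change _ = (ContinuousLinearMap.inverse (G x)) v α
  rw [hΦ, ContinuousLinearMap.inverse_equiv]
  change _ = Φ.symm v α
  rw [hΦ', ContinuousLinearMap.inCoordinates_eq hx' (by trivial)]
  simp [HamPhase.dualFrame_apply, ← hT]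

/-- A coefficient is the pairing with a dual frame vector. The section may live along a map `b`, as
needed for first components of prolongation sections. -/
theorem contMDiffAt_coeff (hU : IsOpen U) {b : M → Q} {s : ∀ x, E (b x)} {x₀ : M}
    (hx₀ : b x₀ ∈ U)
    (hs : ContMDiffAt IM ((𝓡 n).prod 𝓘(ℝ, EuclideanSpace ℝ (Fin m))) ∞
      (fun x ↦ (⟨b x, s x⟩ : TotalSpace (EuclideanSpace ℝ (Fin m)) E)) x₀) (α : Fin m) :
    ContMDiffAt IM 𝓘(ℝ) ∞ (fun x ↦ he.coeff α (b x) (s x)) x₀ := by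
  have hb : ContMDiffAt IM (𝓡 n) ∞ b x₀ := (contMDiffAt_totalSpace.1 hs).1
  have h := ((he.contMDiffAt_dualFrame hU hx₀ α).comp x₀ hb).dual_apply hs
  refine h.congr_of_eventuallyEq (Eventually.of_forall fun x ↦ ?_)
  exact (HamPhase.dualFrame_apply he α (b x) (s x)).symm

end IsLocalFrameOn

end Pairing

/-! ### The Liouville 2-sections in a frame, and independence of the frame. -/

section FrameExpression

variable {k n m : ℕ} {Q : Type*} [TopologicalSpace Q]
  [ChartedSpace (EuclideanSpace ℝ (Fin n)) Q] [IsManifold (𝓡 n) ∞ Q]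
  {E : Q → Type*} [∀ q, AddCommGroup (E q)] [∀ q, Module ℝ (E q)] [∀ q, TopologicalSpace (E q)]
  [∀ q, IsTopologicalAddGroup (E q)] [∀ q, ContinuousSMul ℝ (E q)]
  [TopologicalSpace (TotalSpace (EuclideanSpace ℝ (Fin m)) E)]
  [FiberBundle (EuclideanSpace ℝ (Fin m)) E] [VectorBundle ℝ (EuclideanSpace ℝ (Fin m)) E]
  [ContMDiffVectorBundle ∞ (EuclideanSpace ℝ (Fin m)) E (𝓡 n)]

set_option linter.unusedSectionVars false in
theorem IsLocalFrameOn.sum_coeff_smul {e : Fin m → ∀ q, E q} {U : Set Q}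
    (he : IsLocalFrameOn (𝓡 n) (EuclideanSpace ℝ (Fin m)) ∞ e U) {q : Q} (hq : q ∈ U) (v : E q) :
    ∑ α, he.coeff α q v • e α q = v := by
  simpa [IsLocalFrameOn.coeff, hq] using (he.toBasisAt hq).sum_repr v

/-- The coordinate expression `a^μ w(y_μ) - b^ν v(y_ν) + y_λ 𝒞^λ_{μν} a^μ b^ν` of
`Ω^A((a, v), (b, w))` in the local frame `e` of `E`. -/
noncomputable def LieAlgebroid.frameTwoForm (𝔄 : LieAlgebroid n m E) {e : Fin m → ∀ q, E q} {U : Set Q}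
    (he : IsLocalFrameOn (𝓡 n) (EuclideanSpace ℝ (Fin m)) ∞ e U) (A : Fin k)
    (p : HamPhase k m E) (z z' : E p.proj × TangentSpace (hamModel k n m) p) : ℝ :=
  ∑ μ, he.coeff μ p.proj z.1 *
      dirDeriv (hamModel k n m) (fun x : HamPhase k m E ↦ x.covector A (e μ x.proj)) p z'.2 -
    ∑ ν, he.coeff ν p.proj z'.1 *
      dirDeriv (hamModel k n m) (fun x : HamPhase k m E ↦ x.covector A (e ν x.proj)) p z.2 +
    ∑ μ, ∑ ν, he.coeff μ p.proj z.1 * he.coeff ν p.proj z'.1 *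
      p.covector A (𝔄.localBracket (e μ) (e ν) p.proj)

/-- The algebra of a change of frame: `c`, `d` are the components of two vectors in the old frame,
`M` is the transition matrix, `D μ α ν` the derivative of `M μ α` along the anchor of the `ν`-th old
frame vector, and `y`, `V`, `W`, `C` are data of the new frame. All terms with `D` cancel. -/
theorem sum_change_of_frame {ι κ : Type*} [Fintype ι] [Fintype κ] (c d : ι → ℝ) (M : ι → κ → ℝ)
    (D : ι → κ → ι → ℝ) (y V W : κ → ℝ) (C : κ → κ → ℝ) :
    ∑ μ, c μ * ∑ α, ((∑ ν, d ν * D μ α ν) * y α + M μ α * W α) -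
        ∑ ν, d ν * ∑ α, ((∑ μ, c μ * D ν α μ) * y α + M ν α * V α) +
        ∑ μ, ∑ ν, c μ * d ν *
          (∑ α, (D ν α μ - D μ α ν) * y α + ∑ α, ∑ β, M μ α * M ν β * C α β) =
      ∑ α, (∑ μ, c μ * M μ α) * W α - ∑ α, (∑ ν, d ν * M ν α) * V α +
        ∑ α, ∑ β, (∑ μ, c μ * M μ α) * (∑ ν, d ν * M ν β) * C α β := by
  have h1 : ∀ (c : ι → ℝ) (W : κ → ℝ),
      ∑ μ, c μ * ∑ α, M μ α * W α = ∑ α, (∑ μ, c μ * M μ α) * W α := by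
    intro c W
    simp_rw [Finset.mul_sum, Finset.sum_mul]
    rw [Finset.sum_comm]
    simp only [mul_assoc]
  have h2 : ∀ c d : ι → ℝ, ∑ μ, c μ * ∑ α, (∑ ν, d ν * D μ α ν) * y α =
      ∑ μ, ∑ ν, c μ * d ν * ∑ α, D μ α ν * y α := by
    intro c d
    refine Finset.sum_congr rfl fun μ _ ↦ ?_
    simp_rw [Finset.mul_sum, Finset.sum_mul, Finset.mul_sum]
    rw [Finset.sum_comm]
    simp only [mul_assoc]
  have h3 : ∑ μ, ∑ ν, c μ * d ν * ∑ α, ∑ β, M μ α * M ν β * C α β =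
      ∑ α, ∑ β, (∑ μ, c μ * M μ α) * (∑ ν, d ν * M ν β) * C α β := by
    have hβ : ∀ μ, ∑ ν, c μ * d ν * ∑ α, ∑ β, M μ α * M ν β * C α β =
        c μ * ∑ α, M μ α * ∑ β, (∑ ν, d ν * M ν β) * C α β := by
      intro μ
      simp_rw [← h1 d, Finset.mul_sum]
      rw [Finset.sum_comm]
      exact Finset.sum_congr rfl fun α _ ↦ Finset.sum_congr rfl fun ν _ ↦
        Finset.sum_congr rfl fun β _ ↦ by ring
    simp_rw [hβ, h1]
    refine Finset.sum_congr rfl fun α _ ↦ ?_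
    rw [Finset.mul_sum]
    exact Finset.sum_congr rfl fun β _ ↦ (mul_assoc _ _ _).symm
  have h4 : ∑ μ, ∑ ν, c μ * d ν * ∑ α, D ν α μ * y α =
      ∑ ν, ∑ μ, d ν * c μ * ∑ α, D ν α μ * y α := by
    rw [Finset.sum_comm]
    simp only [mul_comm (c _) (d _)]
  simp_rw [sub_mul, Finset.sum_sub_distrib, Finset.sum_add_distrib, mul_add, mul_sub,
    Finset.sum_add_distrib, Finset.sum_sub_distrib]
  rw [h1, h1, h2, h2, h3, h4]
  ring

namespace LieAlgebroid

variable (𝔄 : LieAlgebroid n m E)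

theorem liouville_eq_sum {e : Fin m → ∀ q, E q} {U : Set Q}
    (he : IsLocalFrameOn (𝓡 n) (EuclideanSpace ℝ (Fin m)) ∞ e U) (A : Fin k)
    {p : HamPhase k m E} (hp : p.proj ∈ U) (z : E p.proj × TangentSpace (hamModel k n m) p) :
    HamPhase.liouville A p z =
      ∑ μ, p.covector A (e μ p.proj) * he.coeff μ p.proj z.1 := by
  change p.covector A z.1 = _
  conv_lhs => rw [← he.sum_coeff_smul hp z.1, map_sum]
  refine Finset.sum_congr rfl fun μ _ ↦ ?_
  rw [map_smul, smul_eq_mul, mul_comm]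

/-- Product rule for `Θ^A(Z) = y_μ a^μ`, an identity that holds near `p` and hence suffices for
derivatives at `p`. -/
theorem dFun_liouville {e : Fin m → ∀ q, E q} {U : Set Q} (hU : IsOpen U)
    (he : IsLocalFrameOn (𝓡 n) (EuclideanSpace ℝ (Fin m)) ∞ e U) (A : Fin k)
    {p : HamPhase k m E} (hp : p.proj ∈ U) {W : Set (HamPhase k m E)} (hW : IsOpen W) (hpW : p ∈ W)
    {Z : HamPhase.PairField k n m E}
    (hZ : 𝔄.IsProlongationSection (hamModel k n m) HamPhase.proj Z W)
    (Z' : HamPhase.PairField k n m E) :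
    dFun (hamModel k n m) HamPhase.proj (fun x ↦ HamPhase.liouville A x (Z x)) Z' p =
      ∑ μ, (he.coeff μ p.proj (Z p).1 * dirDeriv (hamModel k n m)
          (fun x : HamPhase k m E ↦ x.covector A (e μ x.proj)) p (Z' p).2 +
        p.covector A (e μ p.proj) * dirDeriv (hamModel k n m)
          (fun x : HamPhase k m E ↦ he.coeff μ x.proj (Z x).1) p (Z' p).2) := by
  have hy : ∀ μ, MDifferentiableAt (hamModel k n m) 𝓘(ℝ)
      (fun x : HamPhase k m E ↦ x.covector A (e μ x.proj)) p := fun μ ↦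
    (HamPhase.contMDiffAt_covector_apply A (he.contMDiffAt hU hp μ)).mdifferentiableAt (by simp)
  have hb : ∀ μ, MDifferentiableAt (hamModel k n m) 𝓘(ℝ)
      (fun x : HamPhase k m E ↦ he.coeff μ x.proj (Z x).1) p := fun μ ↦
    (he.contMDiffAt_coeff hU (b := HamPhase.proj) hp
      (hZ.smooth_fst.contMDiffAt (hW.mem_nhds hpW)) μ).mdifferentiableAt (by simp)
  have h : (fun x ↦ HamPhase.liouville A x (Z x)) =ᶠ[𝓝 p]
      fun x ↦ ∑ μ, x.covector A (e μ x.proj) * he.coeff μ x.proj (Z x).1 := by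
    filter_upwards [(HamPhase.contMDiff_proj (n := n)).continuous.continuousAt.preimage_mem_nhds
      (hU.mem_nhds hp)] with x hx
    exact liouville_eq_sum he A hx (Z x)
  unfold dFun
  rw [dirDeriv_congr h, dirDeriv_sum _
    (f := fun μ (x : HamPhase k m E) ↦ x.covector A (e μ x.proj) * he.coeff μ x.proj (Z x).1)
    fun μ _ ↦ (hy μ).mul (hb μ)]
  refine Finset.sum_congr rfl fun μ _ ↦ ?_
  rw [dirDeriv_mul (hy μ) (hb μ)]
  ring

/-- The expression of `Ω^A` in the frame given by the preferred trivialization. -/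
theorem liouvilleTwo_eq_frameTwoForm_localFrame (A : Fin k) {p : HamPhase k m E}
    {W : Set (HamPhase k m E)} (hW : IsOpen W) (hpW : p ∈ W) {Z Z' : HamPhase.PairField k n m E}
    (hZ : 𝔄.IsProlongationSection (hamModel k n m) HamPhase.proj Z W)
    (hZ' : 𝔄.IsProlongationSection (hamModel k n m) HamPhase.proj Z' W) :
    HamPhase.liouvilleTwo 𝔄 A Z Z' p =
      𝔄.frameTwoForm ((trivializationAt (EuclideanSpace ℝ (Fin m)) E
        p.proj).isLocalFrameOn_localFrame_baseSet (𝓡 n) ∞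
          (EuclideanSpace.basisFun (Fin m) ℝ).toBasis) A p (Z p) (Z' p) := by
  set T := trivializationAt (EuclideanSpace ℝ (Fin m)) E p.proj with hT
  set b := (EuclideanSpace.basisFun (Fin m) ℝ).toBasis with hb
  have hp : p.proj ∈ T.baseSet := FiberBundle.mem_baseSet_trivializationAt _ _ _
  have hu := T.isLocalFrameOn_localFrame_baseSet (𝓡 n) ∞ b
  -- The bracket is defined by components read off the trivialization. Over its base set they are
  -- the coefficients in the associated frame.
  have hcoeff : ∀ (Z : HamPhase.PairField k n m E) (γ : Fin m) (x : HamPhase k m E),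
      x.proj ∈ T.baseSet →
      frameComponents (hamModel k n m) HamPhase.proj Z p x γ = hu.coeff γ x.proj (Z x).1 := by
    intro Z γ x hx
    have hb' : T.basisAt b hx = hu.toBasisAt hx := by
      ext j
      simp [IsLocalFrameOn.toBasisAt, hx]
    have : hu.coeff γ x.proj (Z x).1 = (T.basisAt b hx).repr (Z x).1 γ := by
      simp [IsLocalFrameOn.coeff, hx, hb']
    rw [this]
    simp [Bundle.Trivialization.basisAt, frameComponents, ← hT, hb]
  have hnear : ∀ᶠ x in 𝓝 p, x.proj ∈ T.baseSet :=
    (HamPhase.contMDiff_proj (n := n)).continuous.continuousAt.preimage_mem_nhds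
      (T.open_baseSet.mem_nhds hp)
  have hderiv : ∀ {Z : HamPhase.PairField k n m E},
      𝔄.IsProlongationSection (hamModel k n m) HamPhase.proj Z W →
      ∀ (γ : Fin m) (v : TangentSpace (hamModel k n m) p),
      @WithLp.ofLp 2 (Fin m → ℝ) (mfderiv (hamModel k n m) 𝓘(ℝ, EuclideanSpace ℝ (Fin m))
        (frameComponents (m := m) (hamModel k n m) HamPhase.proj Z p) p v) γ =
      dirDeriv (hamModel k n m) (fun x ↦ hu.coeff γ x.proj (Z x).1) p v := by
    intro Z hZ γ v
    have hdiff : MDifferentiableAt (hamModel k n m) 𝓘(ℝ, EuclideanSpace ℝ (Fin m))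
        (frameComponents (hamModel k n m) HamPhase.proj Z p) p :=
      (contMDiffAt_totalSpace.1 (hZ.smooth_fst.contMDiffAt (hW.mem_nhds hpW))).2.mdifferentiableAt
        (by simp)
    rw [← dirDeriv_congr (f := fun x ↦ frameComponents (hamModel k n m) HamPhase.proj Z p x γ)
      (hnear.mono fun x hx ↦ hcoeff Z γ x hx)]
    exact (dirDeriv_clm_comp (EuclideanSpace.proj γ : EuclideanSpace ℝ (Fin m) →L[ℝ] ℝ)
      hdiff).symm
  have hbr : HamPhase.liouville A p
      (𝔄.prolongationBracket (hamModel k n m) HamPhase.proj Z Z' p) =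
      ∑ γ, (dirDeriv (hamModel k n m) (fun x ↦ hu.coeff γ x.proj (Z' x).1) p (Z p).2 -
        dirDeriv (hamModel k n m) (fun x ↦ hu.coeff γ x.proj (Z x).1) p (Z' p).2) *
          p.covector A (T.localFrame b γ p.proj) +
      ∑ α, ∑ β, hu.coeff α p.proj (Z p).1 * hu.coeff β p.proj (Z' p).1 *
        p.covector A (𝔄.localBracket (T.localFrame b α) (T.localFrame b β) p.proj) := by
    change p.covector A (𝔄.prolongationBracket (hamModel k n m) HamPhase.proj Z Z' p).1 = _
    simp only [prolongationBracket, ← hT, ← hb, map_add, map_sum, map_smul, smul_eq_mul,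
      hderiv hZ, hderiv hZ', hcoeff _ _ p hp]
    rfl
  -- The derivatives of the components of `Z` and `Z'` occur once in the two `dFun` terms and once,
  -- with the opposite sign, in the bracket term.
  unfold HamPhase.liouvilleTwo dOne frameTwoForm
  rw [𝔄.dFun_liouville T.open_baseSet hu A hp hW hpW hZ',
    𝔄.dFun_liouville T.open_baseSet hu A hp hW hpW hZ, hbr]
  simp only [Finset.sum_add_distrib, sub_mul, Finset.sum_sub_distrib]
  simp only [mul_comm (p.covector A (T.localFrame b _ p.proj))]
  ring

variable [T2Space Q]

/-- Writing `e_μ = M_μ^α u_α`, both `y_μ` and `⟦e_μ, e_ν⟧` produce derivatives of `M`. They cancel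
only for vectors of the prolongation, where differentiating `M ∘ proj` along the vector agrees with
differentiating `M` along the anchor. -/
theorem frameTwoForm_eq_frameTwoForm {e u : Fin m → ∀ q, E q} {U V : Set Q} (hU : IsOpen U)
    (hV : IsOpen V) (he : IsLocalFrameOn (𝓡 n) (EuclideanSpace ℝ (Fin m)) ∞ e U)
    (hu : IsLocalFrameOn (𝓡 n) (EuclideanSpace ℝ (Fin m)) ∞ u V) (A : Fin k)
    {p : HamPhase k m E} (hpU : p.proj ∈ U) (hpV : p.proj ∈ V)
    {z z' : E p.proj × TangentSpace (hamModel k n m) p}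
    (hz : z ∈ 𝔄.prolongation (hamModel k n m) HamPhase.proj p)
    (hz' : z' ∈ 𝔄.prolongation (hamModel k n m) HamPhase.proj p) :
    𝔄.frameTwoForm he A p z z' = 𝔄.frameTwoForm hu A p z z' := by
  let M : Fin m → Fin m → Q → ℝ := fun μ α q ↦ hu.coeff α q (e μ q)
  have hM : ∀ μ α, ContMDiffOn (𝓡 n) 𝓘(ℝ) ∞ (M μ α) (U ∩ V) := fun μ α x hx ↦
    (hu.contMDiffAt_coeff hV (b := fun x ↦ x) (s := fun x ↦ e μ x) hx.2
      (he.contMDiffAt hU hx.1 μ) α).contMDiffWithinAt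
  have hUV : IsOpen (U ∩ V) := hU.inter hV
  have hp : p.proj ∈ U ∩ V := ⟨hpU, hpV⟩
  have heu : ∀ μ, ∀ x ∈ V, e μ x = ∑ α, M μ α x • u α x :=
    fun μ x hx ↦ (hu.sum_coeff_smul hx (e μ x)).symm
  have hMd : ∀ μ α, MDifferentiableAt (𝓡 n) 𝓘(ℝ) (M μ α) p.proj := fun μ α ↦
    ((hM μ α).contMDiffAt (hUV.mem_nhds hp)).mdifferentiableAt (by simp)
  have hproj : MDifferentiableAt (hamModel k n m) (𝓡 n) (HamPhase.proj : HamPhase k m E → Q) p :=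
    (HamPhase.contMDiff_proj (n := n) p).mdifferentiableAt (by simp)
  have hy : ∀ α, MDifferentiableAt (hamModel k n m) 𝓘(ℝ)
      (fun x : HamPhase k m E ↦ x.covector A (u α x.proj)) p := fun α ↦
    (HamPhase.contMDiffAt_covector_apply A (hu.contMDiffAt hV hpV α)).mdifferentiableAt (by simp)
  have hanchor : ∀ (a : E p.proj) μ α, dirDeriv (𝓡 n) (M μ α) p.proj (𝔄.anchor p.proj a) =
      ∑ ν, he.coeff ν p.proj a * dirDeriv (𝓡 n) (M μ α) p.proj (𝔄.anchor p.proj (e ν p.proj)) := by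
    intro a μ α
    conv_lhs => rw [← he.sum_coeff_smul hpU a]
    simp only [map_sum, map_smul, dirDeriv_sum_vec, dirDeriv_smul_vec]
  have hcoeff : ∀ (a : E p.proj) α,
      hu.coeff α p.proj a = ∑ μ, he.coeff μ p.proj a * M μ α p.proj := by
    intro a α
    conv_lhs => rw [← he.sum_coeff_smul hpU a]
    simp only [map_sum, map_smul, smul_eq_mul, M]
  have hdy : ∀ {z : E p.proj × TangentSpace (hamModel k n m) p},
      z ∈ 𝔄.prolongation (hamModel k n m) HamPhase.proj p → ∀ μ, dirDeriv (hamModel k n m)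
        (fun x : HamPhase k m E ↦ x.covector A (e μ x.proj)) p z.2 =
      ∑ α, ((∑ ν, he.coeff ν p.proj z.1 *
          dirDeriv (𝓡 n) (M μ α) p.proj (𝔄.anchor p.proj (e ν p.proj))) *
            p.covector A (u α p.proj) +
        M μ α p.proj * dirDeriv (hamModel k n m)
          (fun x : HamPhase k m E ↦ x.covector A (u α x.proj)) p z.2) := by
    intro z hz μ
    have hev : (fun x : HamPhase k m E ↦ x.covector A (e μ x.proj)) =ᶠ[𝓝 p]
        fun x ↦ ∑ α, M μ α x.proj * x.covector A (u α x.proj) := by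
      filter_upwards [(HamPhase.contMDiff_proj (n := n)).continuous.continuousAt.preimage_mem_nhds
        (hV.mem_nhds hpV)] with x hx
      rw [heu μ x.proj hx, map_sum]
      simp only [map_smul, smul_eq_mul]
    have hMp : ∀ α, MDifferentiableAt (hamModel k n m) 𝓘(ℝ)
        (fun x : HamPhase k m E ↦ M μ α x.proj) p := fun α ↦ (hMd μ α).comp p hproj
    rw [dirDeriv_congr hev, dirDeriv_sum _
      (f := fun α (x : HamPhase k m E) ↦ M μ α x.proj * x.covector A (u α x.proj))
      fun α _ ↦ (hMp α).mul (hy α)]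
    refine Finset.sum_congr rfl fun α _ ↦ ?_
    rw [dirDeriv_mul (hMp α) (hy α), dirDeriv_comp (hMd μ α) hproj, ← hanchor]
    congr 3
    -- This is the prolongation condition `ρ(a) = T proj (v)`.
    exact hz.symm
  have hbr : ∀ μ ν, p.covector A (𝔄.localBracket (e μ) (e ν) p.proj) =
      ∑ α, (dirDeriv (𝓡 n) (M ν α) p.proj (𝔄.anchor p.proj (e μ p.proj)) -
        dirDeriv (𝓡 n) (M μ α) p.proj (𝔄.anchor p.proj (e ν p.proj))) *
          p.covector A (u α p.proj) +
      ∑ α, ∑ β, M μ α p.proj * M ν β p.proj *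
        p.covector A (𝔄.localBracket (u α) (u β) p.proj) := by
    intro μ ν
    have hev : ∀ μ, ∀ᶠ x in 𝓝 p.proj, e μ x = ∑ α, M μ α x • u α x := fun μ ↦
      eventually_of_mem (hV.mem_nhds hpV) (heu μ)
    rw [𝔄.localBracket_congr (hev μ) (hev ν), 𝔄.localBracket_sum_smul hUV hp
      (fun i ↦ (hu.contMDiffOn i).mono inter_subset_right) (hM μ) (hM ν), ← heu μ _ hpV,
      ← heu ν _ hpV]
    simp only [map_add, map_sum, map_smul, smul_eq_mul]
  unfold frameTwoForm
  simp only [hdy hz, hdy hz', hbr, hcoeff]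
  exact sum_change_of_frame _ _ (fun μ α ↦ M μ α p.proj)
    (fun μ α ν ↦ dirDeriv (𝓡 n) (M μ α) p.proj (𝔄.anchor p.proj (e ν p.proj))) _ _ _ _

/-- The right side involves only the values at `p`, so `Ω^A` is tensorial on sections of the
prolongation. -/
theorem liouvilleTwo_eq_frameTwoForm {e : Fin m → ∀ q, E q} {U : Set Q} (hU : IsOpen U)
    (he : IsLocalFrameOn (𝓡 n) (EuclideanSpace ℝ (Fin m)) ∞ e U) (A : Fin k)
    {p : HamPhase k m E} (hp : p.proj ∈ U) {W : Set (HamPhase k m E)} (hW : IsOpen W) (hpW : p ∈ W)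
    {Z Z' : HamPhase.PairField k n m E}
    (hZ : 𝔄.IsProlongationSection (hamModel k n m) HamPhase.proj Z W)
    (hZ' : 𝔄.IsProlongationSection (hamModel k n m) HamPhase.proj Z' W) :
    HamPhase.liouvilleTwo 𝔄 A Z Z' p = 𝔄.frameTwoForm he A p (Z p) (Z' p) := by
  rw [𝔄.liouvilleTwo_eq_frameTwoForm_localFrame A hW hpW hZ hZ']
  exact 𝔄.frameTwoForm_eq_frameTwoForm (Bundle.Trivialization.open_baseSet _) hU _ he A
    (FiberBundle.mem_baseSet_trivializationAt _ _ _) hp (hZ.mem p hpW) (hZ'.mem p hpW)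

end LieAlgebroid

end FrameExpression

/-! ### Pushing tangent vectors and vector fields forward. -/

section Pushforward

variable {EM HM M EM' HM' M' EN HN N : Type*}
  [NormedAddCommGroup EM] [NormedSpace ℝ EM] [TopologicalSpace HM] [TopologicalSpace M]
  [ChartedSpace HM M] {I : ModelWithCorners ℝ EM HM}
  [NormedAddCommGroup EM'] [NormedSpace ℝ EM'] [TopologicalSpace HM'] [TopologicalSpace M']
  [ChartedSpace HM' M'] {I' : ModelWithCorners ℝ EM' HM'}
  [NormedAddCommGroup EN] [NormedSpace ℝ EN] [TopologicalSpace HN] [TopologicalSpace N]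
  [ChartedSpace HN N] {J : ModelWithCorners ℝ EN HN}

theorem ContMDiffAt.mfderiv_vectorField [IsManifold I 1 M] [IsManifold I' 1 M']
    {f : M → M'} {b : N → M} {v : ∀ x, TangentSpace I (b x)}
    {x₀ : N} (hf : ContMDiffAt I I' ∞ f (b x₀))
    (hv : ContMDiffAt J I.tangent ∞ (fun x ↦ (⟨b x, v x⟩ : TangentBundle I M)) x₀) :
    ContMDiffAt J I'.tangent ∞
      (fun x ↦ (⟨f (b x), mfderiv I I' f (b x) (v x)⟩ : TangentBundle I' M')) x₀ := by
  have hb : ContMDiffAt J I ∞ b x₀ := (contMDiffAt_totalSpace.1 hv).1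
  have A : ContMDiffAt I 𝓘(ℝ, EM →L[ℝ] EM') ∞
      (fun y ↦ ContinuousLinearMap.inCoordinates EM (TangentSpace I (M := M)) EM'
        (TangentSpace I' (M := M')) (b x₀) y (f (b x₀)) (f y) (mfderiv I I' f y)) (b x₀) :=
    ContMDiffAt.mfderiv_const hf (by simp)
  exact ContMDiffAt.clm_apply_of_inCoordinates (A.comp x₀ hb) hv (hf.comp x₀ hb)

/-- A chain rule with the base point `y` tied to `f x` by a propositional equality. It serves for
`ofCoords (coords p) = p`, which does not hold definitionally, and avoids transport between tangent
spaces. -/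
theorem mfderiv_apply_mfderiv_of_eq {f : N → M} {g : M → M'} {x : N} {y : M} (hy : f x = y)
    (hg : MDifferentiableAt I I' g y) (hf : MDifferentiableAt J I f x) (v : TangentSpace J x) :
    mfderiv I I' g y (mfderiv J I f x v) = mfderiv J I' (fun z ↦ g (f z)) x v := by
  subst hy
  have h := mfderiv_comp x hg hf
  change _ = mfderiv J I' (g ∘ f) x v
  rw [h]
  rfl

theorem dirDeriv_mfderiv_of_eq {f : N → M} {g : M → ℝ} {x : N} {y : M} (hy : f x = y)
    (hg : MDifferentiableAt I 𝓘(ℝ) g y) (hf : MDifferentiableAt J I f x) (v : TangentSpace J x) :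
    dirDeriv I g y (mfderiv J I f x v) = dirDeriv J (fun z ↦ g (f z)) x v := by
  subst hy
  exact (dirDeriv_comp hg hf).symm

theorem contMDiffAt_tangentBundle_vectorSpace {G : Type*} [NormedAddCommGroup G] [NormedSpace ℝ G]
    {b v : N → G} {x₀ : N} (hb : ContMDiffAt J 𝓘(ℝ, G) ∞ b x₀)
    (hv : ContMDiffAt J 𝓘(ℝ, G) ∞ v x₀) :
    ContMDiffAt J 𝓘(ℝ, G).tangent ∞ (fun x ↦ (⟨b x, v x⟩ : TangentBundle 𝓘(ℝ, G) G)) x₀ :=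
  contMDiffAt_totalSpace.2 ⟨hb, by convert! hv; simp⟩

theorem totalSpace_mk_tangentSpace_eq {y z : M} (h : z = y) (w : TangentSpace I z) :
    (⟨y, w⟩ : TangentBundle I M) = ⟨z, w⟩ := by
  subst h
  rfl

end Pushforward

/-! ### Coordinates on the phase space and test sections of the prolongation. -/

section CoordinateFields

variable {k n m : ℕ} {Q : Type*} [TopologicalSpace Q]
  [ChartedSpace (EuclideanSpace ℝ (Fin n)) Q]
  {E : Q → Type*} [∀ q, AddCommGroup (E q)] [∀ q, Module ℝ (E q)] [∀ q, TopologicalSpace (E q)]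
  [TopologicalSpace (TotalSpace (EuclideanSpace ℝ (Fin m)) E)]
  [FiberBundle (EuclideanSpace ℝ (Fin m)) E] [VectorBundle ℝ (EuclideanSpace ℝ (Fin m)) E]
  {φ : OpenPartialHomeomorph Q (EuclideanSpace ℝ (Fin n))}
  {e : Fin m → ∀ q, E q}

namespace HamPhase

theorem isOpen_preimage_proj {U : Set Q} (hU : IsOpen U) :
    IsOpen (HamPhase.proj ⁻¹' U : Set (HamPhase k m E)) :=
  hU.preimage ((FiberBundle.continuous_proj (Fin k → EuclideanSpace ℝ (Fin m) →L[ℝ] ℝ)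
    (WhitneySum k (DualBundle E))).comp continuous_snd)

theorem contMDiffAt_coords (hφ : φ ∈ IsManifold.maximalAtlas (𝓡 n) ∞ Q)
    (he : IsLocalFrameOn (𝓡 n) (EuclideanSpace ℝ (Fin m)) ∞ e φ.source) {p : HamPhase k m E}
    (hp : p.proj ∈ φ.source) :
    ContMDiffAt (hamModel k n m)
      𝓘(ℝ, EuclideanSpace ℝ (Fin k) × EuclideanSpace ℝ (Fin n) × (Fin k → Fin m → ℝ)) ∞
      (coords φ e : HamPhase k m E → _) p := by
  have h1 : ContMDiffAt (hamModel k n m) 𝓘(ℝ, EuclideanSpace ℝ (Fin k)) ∞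
    (fun x : HamPhase k m E ↦ x.1) p := contMDiffAt_fst
  have h2 : ContMDiffAt (hamModel k n m) 𝓘(ℝ, EuclideanSpace ℝ (Fin n)) ∞
    (fun x : HamPhase k m E ↦ φ x.proj) p :=
    (contMDiffAt_of_mem_maximalAtlas hφ hp).comp p (contMDiff_proj p)
  have h3 : ContMDiffAt (hamModel k n m) 𝓘(ℝ, Fin k → Fin m → ℝ) ∞
    (fun (x : HamPhase k m E) A α ↦ x.covector A (e α x.proj)) p :=
    contMDiffAt_pi_space.2 fun A ↦ contMDiffAt_pi_space.2 fun α ↦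
      contMDiffAt_covector_apply A (he.contMDiffAt φ.open_source hp α)
  exact h1.prodMk_space (h2.prodMk_space h3)

variable [IsManifold (𝓡 n) ∞ Q]
  [∀ q, IsTopologicalAddGroup (E q)] [∀ q, ContinuousSMul ℝ (E q)]
  [ContMDiffVectorBundle ∞ (EuclideanSpace ℝ (Fin m)) E (𝓡 n)]
  (he : IsLocalFrameOn (𝓡 n) (EuclideanSpace ℝ (Fin m)) ∞ e φ.source)

theorem contMDiffAt_ofCoords (hφ : φ ∈ IsManifold.maximalAtlas (𝓡 n) ∞ Q)
    {c : EuclideanSpace ℝ (Fin k) × EuclideanSpace ℝ (Fin n) × (Fin k → Fin m → ℝ)}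
    (hc : c.2.1 ∈ φ.target) :
    ContMDiffAt
      𝓘(ℝ, EuclideanSpace ℝ (Fin k) × EuclideanSpace ℝ (Fin n) × (Fin k → Fin m → ℝ))
      (hamModel k n m) ∞ (ofCoords φ he) c := by
  have hb : ContMDiffAt
      𝓘(ℝ, EuclideanSpace ℝ (Fin k) × EuclideanSpace ℝ (Fin n) × (Fin k → Fin m → ℝ))
      (𝓡 n) ∞ (fun c ↦ φ.symm c.2.1) c :=
    (contMDiffAt_symm_of_mem_maximalAtlas hφ hc).comp c
      (contDiff_fst.comp contDiff_snd).contMDiff.contMDiffAt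
  refine ContMDiffAt.prodMk contDiff_fst.contMDiff.contMDiffAt
    (WhitneySum.contMDiffAt_iff.2 ⟨hb, fun A ↦ contMDiffAt_totalSpace.2 ⟨hb, ?_⟩⟩)
  set T := trivializationAt (EuclideanSpace ℝ (Fin m) →L[ℝ] ℝ) (DualBundle E) (φ.symm c.2.1)
  have hsum : ContMDiffAt
      𝓘(ℝ, EuclideanSpace ℝ (Fin k) × EuclideanSpace ℝ (Fin n) × (Fin k → Fin m → ℝ))
      𝓘(ℝ, EuclideanSpace ℝ (Fin m) →L[ℝ] ℝ) ∞
      (fun c ↦ ∑ α, c.2.2 A α • (T ⟨φ.symm c.2.1, dualFrame he α (φ.symm c.2.1)⟩).2) c := by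
    refine contMDiffAt_finsetSum fun α _ ↦ ?_
    have h1 : ContDiff ℝ ∞ (fun c : EuclideanSpace ℝ (Fin k) × EuclideanSpace ℝ (Fin n) ×
      (Fin k → Fin m → ℝ) ↦ c.2.2 A α) := by fun_prop
    have h2 : ContMDiffAt
        𝓘(ℝ, EuclideanSpace ℝ (Fin k) × EuclideanSpace ℝ (Fin n) × (Fin k → Fin m → ℝ))
        ((𝓡 n).prod 𝓘(ℝ, EuclideanSpace ℝ (Fin m) →L[ℝ] ℝ)) ∞
        (fun c ↦ (⟨φ.symm c.2.1, dualFrame he α (φ.symm c.2.1)⟩ :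
          TotalSpace (EuclideanSpace ℝ (Fin m) →L[ℝ] ℝ) (DualBundle E))) c :=
      ContMDiffAt.comp (g := fun q ↦ (⟨q, dualFrame he α q⟩ :
          TotalSpace (EuclideanSpace ℝ (Fin m) →L[ℝ] ℝ) (DualBundle E)))
        (f := fun c ↦ φ.symm c.2.1) c
        (he.contMDiffAt_dualFrame φ.open_source (φ.map_target hc) α) hb
    exact h1.contMDiff.contMDiffAt.smul (contMDiffAt_totalSpace.1 h2).2
  refine hsum.congr_of_eventuallyEq ?_
  filter_upwards [hb.continuousAt.preimage_mem_nhds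
    (T.open_baseSet.mem_nhds (FiberBundle.mem_baseSet_trivializationAt _ _ _))] with x hx
  have hx' : φ.symm x.2.1 ∈ T.baseSet := hx
  have hT : ∀ v, (T ⟨φ.symm x.2.1, v⟩).2 = T.linearMapAt ℝ (φ.symm x.2.1) v := fun v ↦ by
    rw [T.coe_linearMapAt_of_mem hx']
  simp only [hT, map_sum, map_smul]

theorem ofCoords_coords {p : HamPhase k m E} (hp : p.proj ∈ φ.source) :
    ofCoords φ he (coords φ e p) = p := by
  -- The base point `φ.symm (φ p.proj)` is generalized to `q`, so that the equality of base points
  -- can be substituted although the fibre depends on it.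
  have key : ∀ q : Q, q = p.proj →
      (⟨q, fun A ↦ ∑ α, p.covector A (e α p.proj) • dualFrame he α q⟩ :
        TotalSpace (Fin k → EuclideanSpace ℝ (Fin m) →L[ℝ] ℝ) (WhitneySum k (DualBundle E))) =
      p.2 := by
    rintro q rfl
    have h : (fun A ↦ ∑ α, p.covector A (e α p.proj) • dualFrame he α p.proj) = p.covector := by
      funext A
      ext v
      conv_rhs => rw [← he.sum_coeff_smul hp v, map_sum]
      simp [dualFrame_apply, mul_comm]
    exact congrArg (TotalSpace.mk p.proj) h
  exact Prod.ext rfl (key _ (φ.left_inv hp))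

/-- The tangent vector at `p` with the given components in the coordinates `(t^A, q^i, y^A_α)`. -/
noncomputable def coordVector (p : HamPhase k m E)
    (u : EuclideanSpace ℝ (Fin k) × EuclideanSpace ℝ (Fin n) × (Fin k → Fin m → ℝ)) :
    TangentSpace (hamModel k n m) p :=
  mfderiv 𝓘(ℝ, EuclideanSpace ℝ (Fin k) × EuclideanSpace ℝ (Fin n) × (Fin k → Fin m → ℝ))
    (hamModel k n m) (ofCoords φ he) (coords φ e p) u

/-- This links intrinsic derivatives to `partialQ` and `partialY`, which are defined by
differentiating `H ∘ ofCoords`. -/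
theorem dirDeriv_coordVector (hφ : φ ∈ IsManifold.maximalAtlas (𝓡 n) ∞ Q) {p : HamPhase k m E}
    (hp : p.proj ∈ φ.source)
    (u : EuclideanSpace ℝ (Fin k) × EuclideanSpace ℝ (Fin n) × (Fin k → Fin m → ℝ))
    {f : HamPhase k m E → ℝ}
    (hf : MDifferentiableAt (hamModel k n m) 𝓘(ℝ) f p) :
    dirDeriv (hamModel k n m) f p (coordVector he p u) =
      fderiv ℝ (fun c ↦ f (ofCoords φ he c)) (coords φ e p) u := by
  have h := dirDeriv_mfderiv_of_eq (ofCoords_coords he hp) hf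
    ((contMDiffAt_ofCoords he hφ (c := coords φ e p) (φ.map_source hp)).mdifferentiableAt
      (by simp)) u
  refine Eq.trans h ?_
  unfold dirDeriv
  rw [mfderiv_eq_fderiv]
  rfl

theorem coords_ofCoords_eventuallyEq {p : HamPhase k m E} (hp : p.proj ∈ φ.source) :
    (fun c : EuclideanSpace ℝ (Fin k) × EuclideanSpace ℝ (Fin n) × (Fin k → Fin m → ℝ) ↦
      coords φ e (ofCoords φ he c)) =ᶠ[𝓝 (coords φ e p)] fun c ↦ c := by
  have h : ContinuousAt (fun c : EuclideanSpace ℝ (Fin k) × EuclideanSpace ℝ (Fin n) ×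
      (Fin k → Fin m → ℝ) ↦ c.2.1) (coords φ e p) := by fun_prop
  filter_upwards [h.preimage_mem_nhds (φ.open_target.mem_nhds (φ.map_source hp))] with c hc
  exact coords_ofCoords φ he c hc (φ.map_target hc)

theorem dirDeriv_covector_coordVector (hφ : φ ∈ IsManifold.maximalAtlas (𝓡 n) ∞ Q) {p : HamPhase k m E}
    (hp : p.proj ∈ φ.source)
    (u : EuclideanSpace ℝ (Fin k) × EuclideanSpace ℝ (Fin n) × (Fin k → Fin m → ℝ))
    (A : Fin k) (α : Fin m) :
    dirDeriv (hamModel k n m) (fun x : HamPhase k m E ↦ x.covector A (e α x.proj)) p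
      (coordVector he p u) = u.2.2 A α := by
  rw [dirDeriv_coordVector he hφ hp u ((contMDiffAt_covector_apply A
    (he.contMDiffAt φ.open_source hp α)).mdifferentiableAt (by simp))]
  have h : (fun c : EuclideanSpace ℝ (Fin k) × EuclideanSpace ℝ (Fin n) × (Fin k → Fin m → ℝ) ↦
      (ofCoords φ he c).covector A (e α (ofCoords φ he c).proj)) =ᶠ[𝓝 (coords φ e p)]
      fun c ↦ c.2.2 A α :=
    (coords_ofCoords_eventuallyEq he hp).mono fun c hc ↦
      congrArg (fun c ↦ c.2.2 A α) hc
  rw [h.fderiv_eq]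
  let L : (EuclideanSpace ℝ (Fin k) × EuclideanSpace ℝ (Fin n) × (Fin k → Fin m → ℝ)) →L[ℝ] ℝ :=
    (ContinuousLinearMap.proj (R := ℝ) (φ := fun _ : Fin m ↦ ℝ) α).comp
      ((ContinuousLinearMap.proj (R := ℝ) (φ := fun _ : Fin k ↦ Fin m → ℝ) A).comp
        ((ContinuousLinearMap.snd ℝ _ _).comp (ContinuousLinearMap.snd ℝ _ _)))
  change fderiv ℝ L _ u = _
  rw [L.fderiv]
  rfl

theorem dtSection_coordVector (hφ : φ ∈ IsManifold.maximalAtlas (𝓡 n) ∞ Q) {p : HamPhase k m E}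
    (hp : p.proj ∈ φ.source)
    (u : EuclideanSpace ℝ (Fin k) × EuclideanSpace ℝ (Fin n) × (Fin k → Fin m → ℝ))
    (a : E p.proj) (B : Fin k) :
    dtSection B p (a, coordVector he p u) = u.1 B := by
  have hf : MDifferentiableAt (hamModel k n m) 𝓘(ℝ) (fun x : HamPhase k m E ↦ x.1 B) p :=
    ((EuclideanSpace.proj B : EuclideanSpace ℝ (Fin k) →L[ℝ] ℝ).contMDiff.contMDiffAt.comp p
      (contMDiffAt_fst (n := ∞))).mdifferentiableAt (by simp)
  refine (dirDeriv_coordVector he hφ hp u hf).trans ?_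
  let L : (EuclideanSpace ℝ (Fin k) × EuclideanSpace ℝ (Fin n) × (Fin k → Fin m → ℝ)) →L[ℝ] ℝ :=
    (EuclideanSpace.proj B : EuclideanSpace ℝ (Fin k) →L[ℝ] ℝ).comp (ContinuousLinearMap.fst ℝ _ _)
  change fderiv ℝ L _ u = _
  rw [L.fderiv]
  rfl

/-- In coordinates the projection is `c ↦ φ.symm c.2.1`, so the image is the differential of
`φ.symm` applied to that of `φ` at `v`, which is `v`. -/
theorem mfderiv_proj_coordVector (hφ : φ ∈ IsManifold.maximalAtlas (𝓡 n) ∞ Q) {p : HamPhase k m E}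
    (hp : p.proj ∈ φ.source)
    (u : EuclideanSpace ℝ (Fin k) × EuclideanSpace ℝ (Fin n) × (Fin k → Fin m → ℝ))
    {v : TangentSpace (𝓡 n) p.proj}
    (hv : u.2.1 = mfderiv (𝓡 n) (𝓡 n) φ p.proj v) :
    mfderiv (hamModel k n m) (𝓡 n) (HamPhase.proj : HamPhase k m E → Q) p (coordVector he p u) =
      v := by
  have hproj : MDifferentiableAt (hamModel k n m) (𝓡 n) (HamPhase.proj : HamPhase k m E → Q) p :=
    (contMDiff_proj (n := n) p).mdifferentiableAt (by simp)
  refine (mfderiv_apply_mfderiv_of_eq (ofCoords_coords he hp) hproj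
    ((contMDiffAt_ofCoords he hφ (c := coords φ e p) (φ.map_source hp)).mdifferentiableAt
      (by simp)) u).trans ?_
  let L : (EuclideanSpace ℝ (Fin k) × EuclideanSpace ℝ (Fin n) × (Fin k → Fin m → ℝ)) →L[ℝ]
      EuclideanSpace ℝ (Fin n) :=
    (ContinuousLinearMap.fst ℝ _ _).comp (ContinuousLinearMap.snd ℝ _ _)
  have hsymm : MDifferentiableAt (𝓡 n) (𝓡 n) φ.symm (φ p.proj) :=
    (contMDiffAt_symm_of_mem_maximalAtlas hφ (φ.map_source hp)).mdifferentiableAt (by simp)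
  have hφd : MDifferentiableAt (𝓡 n) (𝓡 n) φ p.proj :=
    (contMDiffAt_of_mem_maximalAtlas hφ hp).mdifferentiableAt (by simp)
  have h1 := mfderiv_apply_mfderiv_of_eq (f := L) (x := coords φ e p) (y := φ p.proj) rfl hsymm
    L.differentiableAt.mdifferentiableAt u
  refine h1.symm.trans ?_
  have h2 : mfderiv 𝓘(ℝ, EuclideanSpace ℝ (Fin k) × EuclideanSpace ℝ (Fin n) ×
      (Fin k → Fin m → ℝ)) (𝓡 n) L (coords φ e p) u = mfderiv (𝓡 n) (𝓡 n) φ p.proj v := by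
    rw [mfderiv_eq_fderiv, L.fderiv]
    exact hv
  rw [h2]
  refine (mfderiv_apply_mfderiv_of_eq rfl hsymm hφd v).trans ?_
  have h3 : (fun z ↦ φ.symm (φ z)) =ᶠ[𝓝 p.proj] id :=
    eventually_of_mem (φ.open_source.mem_nhds hp) fun z hz ↦ φ.left_inv hz
  rw [h3.mfderiv_eq, mfderiv_id]
  rfl

/-- The field of pairs `(σ, v)` over a section `σ` of `E`, where `v` has the components
`(0, ρ(σ), η)` in the coordinates `(t^A, q^i, y^A_α)`. -/
noncomputable def coordField (𝔄 : LieAlgebroid n m E) (σ : ∀ q, E q) (η : Fin k → Fin m → ℝ) :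
    PairField k n m E := fun p ↦
  (σ p.proj, coordVector he p
    (0, mfderiv (𝓡 n) (𝓡 n) φ p.proj (𝔄.anchor p.proj (σ p.proj)), η))

/-- The `q`-component was chosen as `ρ(σ)` in the chart so that the vector projects to `ρ(σ)`.
Smoothness holds because the vector is the pushforward by `ofCoords` of a smooth coordinate
expression. -/
theorem isProlongationSection_coordField (𝔄 : LieAlgebroid n m E)
    (hφ : φ ∈ IsManifold.maximalAtlas (𝓡 n) ∞ Q) {σ : ∀ q, E q}
    (hσ : ContMDiffOn (𝓡 n) ((𝓡 n).prod 𝓘(ℝ, EuclideanSpace ℝ (Fin m))) ∞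
      (fun x ↦ TotalSpace.mk' (EuclideanSpace ℝ (Fin m)) x (σ x)) φ.source)
    (η : Fin k → Fin m → ℝ) :
    𝔄.IsProlongationSection (hamModel k n m) HamPhase.proj (coordField he 𝔄 σ η)
      (HamPhase.proj ⁻¹' φ.source) where
  mem p hp := (mfderiv_proj_coordVector he hφ hp _ rfl).symm
  smooth_fst p hp :=
    ((hσ.contMDiffAt (φ.open_source.mem_nhds hp)).comp p (contMDiff_proj p)).contMDiffWithinAt
  smooth_snd := by
    have hD := isOpen_preimage_proj (k := k) (m := m) (E := E) φ.open_source
    intro p hp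
    have hσp := hσ.contMDiffAt (φ.open_source.mem_nhds hp)
    have hx : ContMDiffAt (𝓡 n) 𝓘(ℝ, EuclideanSpace ℝ (Fin n)) ∞
        (fun q ↦ (mfderiv (𝓡 n) (𝓡 n) φ q (𝔄.anchor q (σ q)) : EuclideanSpace ℝ (Fin n)))
        p.proj :=
      (contMDiff_snd_tangentBundle_modelSpace (EuclideanSpace ℝ (Fin n)) (𝓡 n)).contMDiffAt.comp
        p.proj (ContMDiffAt.mfderiv_vectorField (b := fun q ↦ q)
          (contMDiffAt_of_mem_maximalAtlas hφ hp)
          (𝔄.anchor_smooth.contMDiffAt.comp p.proj hσp))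
    have hu : ContMDiffAt (hamModel k n m)
        𝓘(ℝ, EuclideanSpace ℝ (Fin k) × EuclideanSpace ℝ (Fin n) × (Fin k → Fin m → ℝ)) ∞
        (fun x : HamPhase k m E ↦ ((0 : EuclideanSpace ℝ (Fin k)),
          (mfderiv (𝓡 n) (𝓡 n) φ x.proj (𝔄.anchor x.proj (σ x.proj)) : EuclideanSpace ℝ (Fin n)),
          η)) p :=
      contMDiffAt_const.prodMk_space ((hx.comp p (contMDiff_proj p)).prodMk_space
        contMDiffAt_const)
    have h := ContMDiffAt.mfderiv_vectorField (f := ofCoords φ he)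
      (contMDiffAt_ofCoords he hφ (c := coords φ e p) (φ.map_source hp))
      (contMDiffAt_tangentBundle_vectorSpace (contMDiffAt_coords hφ he hp) hu)
    refine (h.congr_of_eventuallyEq ?_).contMDiffWithinAt
    filter_upwards [hD.mem_nhds hp] with x hx
    exact totalSpace_mk_tangentSpace_eq (ofCoords_coords he hx) _

end HamPhase

end CoordinateFields

/-! ### Testing the geometric equation and deriving Hamilton's equations. -/

section HamiltonEquations

variable {k n m : ℕ} {Q : Type*} [TopologicalSpace Q]
  [ChartedSpace (EuclideanSpace ℝ (Fin n)) Q]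
  {E : Q → Type*} [∀ q, AddCommGroup (E q)] [∀ q, Module ℝ (E q)] [∀ q, TopologicalSpace (E q)]
  [TopologicalSpace (TotalSpace (EuclideanSpace ℝ (Fin m)) E)]
  [FiberBundle (EuclideanSpace ℝ (Fin m)) E] [VectorBundle ℝ (EuclideanSpace ℝ (Fin m)) E]
  {ξ : Fin k → HamPhase.PairField k n m E}
  {φ : OpenPartialHomeomorph Q (EuclideanSpace ℝ (Fin n))} {e : Fin m → ∀ q, E q}

namespace HamPhase

theorem partialT_comp_integralSection {W : Set (EuclideanSpace ℝ (Fin k))}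
    {ψ : EuclideanSpace ℝ (Fin k) → HamPhase k m E} (hψ : IsIntegralSection ξ W ψ)
    {t : EuclideanSpace ℝ (Fin k)} (ht : t ∈ W) {f : HamPhase k m E → ℝ}
    (hf : MDifferentiableAt (hamModel k n m) 𝓘(ℝ) f (ψ t)) (A : Fin k) :
    partialT A (fun s ↦ f (ψ s)) t = dirDeriv (hamModel k n m) f (ψ t) (ξ A (ψ t)).2 := by
  rw [← hψ.mfderiv_eq t ht A]
  refine Eq.trans ?_ (dirDeriv_comp hf (hψ.mdifferentiableAt t ht))
  unfold partialT dirDeriv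
  rw [mfderiv_eq_fderiv]
  rfl

variable [IsManifold (𝓡 n) ∞ Q] {𝔄 : LieAlgebroid n m E} {H : HamPhase k m E → ℝ}

theorem fderiv_horizontal_eq_sum_partialQ
    (hφ : φ ∈ IsManifold.maximalAtlas (𝓡 n) ∞ Q)
    (he : IsLocalFrameOn (𝓡 n) (EuclideanSpace ℝ (Fin m)) ∞ e φ.source) {p : HamPhase k m E}
    (hp : p.proj ∈ φ.source) (β : Fin m) :
    fderiv ℝ (fun c ↦ H (ofCoords φ he c)) (coords φ e p)
        (0, mfderiv (𝓡 n) (𝓡 n) φ p.proj (𝔄.anchor p.proj (e β p.proj)), 0) =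
      ∑ i, 𝔄.anchorCoeff φ e i β p.proj * partialQ φ he H i p := by
  have hφd : MDifferentiableAt (𝓡 n) (𝓡 n) φ p.proj :=
    (contMDiffAt_of_mem_maximalAtlas hφ hp).mdifferentiableAt (by simp)
  have hρ : ∀ i, 𝔄.anchorCoeff φ e i β p.proj = @WithLp.ofLp 2 (Fin n → ℝ)
      (mfderiv (𝓡 n) (𝓡 n) φ p.proj (𝔄.anchor p.proj (e β p.proj))) i := fun i ↦
    dirDeriv_clm_comp (EuclideanSpace.proj i : EuclideanSpace ℝ (Fin n) →L[ℝ] ℝ) hφd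
  have hsum : ∀ x : EuclideanSpace ℝ (Fin n),
      ((0, x, 0) : EuclideanSpace ℝ (Fin k) × EuclideanSpace ℝ (Fin n) × (Fin k → Fin m → ℝ)) =
        ∑ i, x i • (0, EuclideanSpace.single i 1, 0) := by
    intro x
    have hx : x = ∑ i, x i • EuclideanSpace.single i (1 : ℝ) := by
      ext j
      simp [Pi.single_apply]
    let L := (ContinuousLinearMap.inr ℝ (EuclideanSpace ℝ (Fin k))
      (EuclideanSpace ℝ (Fin n) × (Fin k → Fin m → ℝ))).comp
        (ContinuousLinearMap.inl ℝ (EuclideanSpace ℝ (Fin n)) (Fin k → Fin m → ℝ))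
    change L x = ∑ i, x i • L (EuclideanSpace.single i 1)
    conv_lhs => rw [hx]
    rw [map_sum]
    simp only [map_smul]
  refine (congrArg _ (hsum _)).trans ?_
  rw [map_sum]
  refine Finset.sum_congr rfl fun i _ ↦ ?_
  rw [map_smul, hρ]
  rfl

variable [∀ q, IsTopologicalAddGroup (E q)] [∀ q, ContinuousSMul ℝ (E q)]
  [ContMDiffVectorBundle ∞ (EuclideanSpace ℝ (Fin m)) E (𝓡 n)]

/-- On the prolongation, `v(q^i) = ρ(a)(q^i)`, and the anchor is linear in the frame components of
`a`. -/
theorem dirDeriv_chart_comp_proj (hφ : φ ∈ IsManifold.maximalAtlas (𝓡 n) ∞ Q)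
    (he : IsLocalFrameOn (𝓡 n) (EuclideanSpace ℝ (Fin m)) ∞ e φ.source) {p : HamPhase k m E}
    (hp : p.proj ∈ φ.source) {z : E p.proj × TangentSpace (hamModel k n m) p}
    (hz : z ∈ 𝔄.prolongation (hamModel k n m) HamPhase.proj p) (i : Fin n) :
    dirDeriv (hamModel k n m) (fun x : HamPhase k m E ↦ φ x.proj i) p z.2 =
      ∑ α, 𝔄.anchorCoeff φ e i α p.proj * he.coeff α p.proj z.1 := by
  have hφi : MDifferentiableAt (𝓡 n) 𝓘(ℝ) (fun q ↦ φ q i) p.proj :=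
    ((EuclideanSpace.proj i : EuclideanSpace ℝ (Fin n) →L[ℝ] ℝ).contMDiff.contMDiffAt.comp p.proj
      (contMDiffAt_of_mem_maximalAtlas hφ hp)).mdifferentiableAt (by simp)
  have hproj : MDifferentiableAt (hamModel k n m) (𝓡 n) (HamPhase.proj : HamPhase k m E → Q) p :=
    (contMDiff_proj (n := n) p).mdifferentiableAt (by simp)
  have hz' : mfderiv (hamModel k n m) (𝓡 n) (HamPhase.proj : HamPhase k m E → Q) p z.2 =
    𝔄.anchor p.proj z.1 := hz.symm
  rw [dirDeriv_comp (f := fun q ↦ φ q i) hφi hproj, hz']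
  conv_lhs => rw [← he.sum_coeff_smul hp z.1]
  simp only [map_sum, map_smul, dirDeriv_sum_vec, dirDeriv_smul_vec]
  exact Finset.sum_congr rfl fun α _ ↦ mul_comm _ _

variable [T2Space Q]

/-- The test section has no `t`-components, so every `𝒴^A` vanishes on it and the terms with
`∂H/∂t^A` drop out. -/
theorem IsHamiltonianSection.sum_frameTwoForm_eq (hξ : IsHamiltonianSection 𝔄 H ξ)
    (hH : ContMDiff (hamModel k n m) 𝓘(ℝ) ∞ H) (hφ : φ ∈ IsManifold.maximalAtlas (𝓡 n) ∞ Q)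
    (he : IsLocalFrameOn (𝓡 n) (EuclideanSpace ℝ (Fin m)) ∞ e φ.source) {p : HamPhase k m E}
    (hp : p.proj ∈ φ.source) {σ : ∀ q, E q}
    (hσ : ContMDiffOn (𝓡 n) ((𝓡 n).prod 𝓘(ℝ, EuclideanSpace ℝ (Fin m))) ∞
      (fun x ↦ TotalSpace.mk' (EuclideanSpace ℝ (Fin m)) x (σ x)) φ.source)
    (η : Fin k → Fin m → ℝ) :
    ∑ A, 𝔄.frameTwoForm he A p (ξ A p) (coordField he 𝔄 σ η p) =
      fderiv ℝ (fun c ↦ H (ofCoords φ he c)) (coords φ e p)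
        (0, mfderiv (𝓡 n) (𝓡 n) φ p.proj (𝔄.anchor p.proj (σ p.proj)), η) := by
  have hZ := isProlongationSection_coordField he 𝔄 hφ hσ η
  have hD := isOpen_preimage_proj (k := k) (m := m) (E := E) φ.open_source
  have h := hξ.geometric_eq _ hD _ hZ p hp
  have hξ' : ∀ A, 𝔄.IsProlongationSection (hamModel k n m) HamPhase.proj (ξ A)
      (HamPhase.proj ⁻¹' φ.source) := fun A ↦
    ⟨fun p _ ↦ (hξ.isSection A).mem p (mem_univ p),
      (hξ.isSection A).smooth_fst.mono (subset_univ _),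
      (hξ.isSection A).smooth_snd.mono (subset_univ _)⟩
  have h0 : ∀ A, dtSection A p (coordField he 𝔄 σ η p) = 0 := fun A ↦
    dtSection_coordVector he hφ hp _ _ A
  simp only [h0, mul_zero, Finset.sum_const_zero, sub_zero] at h
  rw [← dirDeriv_coordVector he hφ hp _ (hH.contMDiffAt.mdifferentiableAt (by simp))]
  refine Eq.trans ?_ h
  exact Finset.sum_congr rfl fun A _ ↦
    (𝔄.liouvilleTwo_eq_frameTwoForm φ.open_source he A hp hD hp (hξ' A) hZ).symm

/-- Test on the vertical section `(0, ∂/∂y^A_α)`: its `E`-component is zero, so of all the forms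
only the term `ξ_A^α · 1` survives. -/
theorem IsHamiltonianSection.coeff_eq_partialY (hξ : IsHamiltonianSection 𝔄 H ξ)
    (hH : ContMDiff (hamModel k n m) 𝓘(ℝ) ∞ H) (hφ : φ ∈ IsManifold.maximalAtlas (𝓡 n) ∞ Q)
    (he : IsLocalFrameOn (𝓡 n) (EuclideanSpace ℝ (Fin m)) ∞ e φ.source) {p : HamPhase k m E}
    (hp : p.proj ∈ φ.source) (A : Fin k) (α : Fin m) :
    he.coeff α p.proj (ξ A p).1 = partialY φ he H A α p := by
  have hσ : ContMDiffOn (𝓡 n) ((𝓡 n).prod 𝓘(ℝ, EuclideanSpace ℝ (Fin m))) ∞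
      (fun x ↦ TotalSpace.mk' (EuclideanSpace ℝ (Fin m)) x (0 : E x)) φ.source :=
    (contMDiff_zeroSection ℝ E).contMDiffOn
  have h := hξ.sum_frameTwoForm_eq hH hφ he hp hσ (Pi.single A (Pi.single α 1))
  have hy : ∀ B μ, dirDeriv (hamModel k n m) (fun x : HamPhase k m E ↦ x.covector B (e μ x.proj)) p
      (coordField he 𝔄 (fun q ↦ (0 : E q)) (Pi.single A (Pi.single α 1)) p).2 =
      (Pi.single A (Pi.single α 1) : Fin k → Fin m → ℝ) B μ := fun B μ ↦
    dirDeriv_covector_coordVector he hφ hp _ B μ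
  have hfst : (coordField he 𝔄 (fun q ↦ (0 : E q)) (Pi.single A (Pi.single α 1)) p).1 = 0 := rfl
  simp only [LieAlgebroid.frameTwoForm, hy, hfst, map_zero, zero_mul, mul_zero,
    Finset.sum_const_zero, sub_zero, add_zero] at h
  rw [Finset.sum_eq_single A (fun B _ hB ↦ by simp [Pi.single_eq_of_ne hB]) (by simp),
    Finset.sum_eq_single α (fun β _ hβ ↦ by simp [Pi.single_eq_of_ne hβ]) (by simp)] at h
  simp only [Pi.single_eq_same, mul_one] at h
  rw [h]
  rfl

/-- Test on `σ = e_β`, `η = 0`: all `y`-derivatives along the test vector vanish, and each `Ω^A`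
reduces to `-ξ_A(y^A_β)` plus the bracket term, where the components of `ξ_A` are already known to
be `∂H/∂y^A_α`. -/
theorem IsHamiltonianSection.sum_dirDeriv_covector (hξ : IsHamiltonianSection 𝔄 H ξ)
    (hH : ContMDiff (hamModel k n m) 𝓘(ℝ) ∞ H) (hφ : φ ∈ IsManifold.maximalAtlas (𝓡 n) ∞ Q)
    (he : IsLocalFrameOn (𝓡 n) (EuclideanSpace ℝ (Fin m)) ∞ e φ.source) {p : HamPhase k m E}
    (hp : p.proj ∈ φ.source) (β : Fin m) :
    ∑ A, dirDeriv (hamModel k n m) (fun x : HamPhase k m E ↦ x.covector A (e β x.proj)) p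
        (ξ A p).2 =
      -(∑ i, 𝔄.anchorCoeff φ e i β p.proj * partialQ φ he H i p +
        ∑ A, ∑ α, ∑ γ, p.covector A (e γ p.proj) *
          𝔄.bracketCoeff he γ β α p.proj * partialY φ he H A α p) := by
  have h := hξ.sum_frameTwoForm_eq hH hφ he hp (he.contMDiffOn β) 0
  rw [fderiv_horizontal_eq_sum_partialQ hφ he hp β] at h
  have hy : ∀ B μ, dirDeriv (hamModel k n m) (fun x : HamPhase k m E ↦ x.covector B (e μ x.proj)) p
      (coordField he 𝔄 (e β) 0 p).2 = 0 := fun B μ ↦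
    dirDeriv_covector_coordVector he hφ hp _ B μ
  have hcoeff : ∀ ν, he.coeff ν p.proj (coordField he 𝔄 (e β) (0 : Fin k → Fin m → ℝ) p).1 =
      if β = ν then 1 else 0 := fun ν ↦ he.coeff_eq_ite hp ν β
  have hbr : ∀ A μ, p.covector A (𝔄.localBracket (e μ) (e β) p.proj) =
      -∑ γ, p.covector A (e γ p.proj) * 𝔄.bracketCoeff he γ β μ p.proj := by
    intro A μ
    -- The form produces `⟦e_μ, e_β⟧`, while the equation uses `𝒞^γ_{βμ}`. Skew-symmetry accounts
    -- for the sign.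
    rw [𝔄.localBracket_skew, map_neg]
    conv_lhs => rw [← he.sum_coeff_smul hp (𝔄.localBracket (e β) (e μ) p.proj), map_sum]
    simp only [map_smul, smul_eq_mul, mul_comm (p.covector A _)]
    rfl
  simp only [LieAlgebroid.frameTwoForm, hy, hcoeff, hξ.coeff_eq_partialY hH hφ he hp, mul_zero,
    Finset.sum_const_zero, zero_sub, mul_ite, ite_mul, mul_one, one_mul, zero_mul,
    Finset.sum_ite_eq, Finset.mem_univ, if_true, hbr, Finset.sum_add_distrib,
    Finset.sum_neg_distrib, mul_neg] at h
  have hC : ∑ A, ∑ α, ∑ γ, p.covector A (e γ p.proj) * 𝔄.bracketCoeff he γ β α p.proj *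
        partialY φ he H A α p =
      ∑ A, ∑ α, partialY φ he H A α p *
        ∑ γ, p.covector A (e γ p.proj) * 𝔄.bracketCoeff he γ β α p.proj := by
    refine Finset.sum_congr rfl fun A _ ↦ Finset.sum_congr rfl fun α _ ↦ ?_
    rw [mul_comm, Finset.sum_mul]
  rw [hC]
  linarith

end HamPhase

end HamiltonEquations


theorem theorem5 {k n m : ℕ}
    {Q : Type*} [TopologicalSpace Q] [T2Space Q] [ChartedSpace (EuclideanSpace ℝ (Fin n)) Q]
    [IsManifold (𝓡 n) ∞ Q]
    {E : Q → Type*} [∀ q, AddCommGroup (E q)] [∀ q, Module ℝ (E q)] [∀ q, TopologicalSpace (E q)]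
    [∀ q, IsTopologicalAddGroup (E q)] [∀ q, ContinuousSMul ℝ (E q)]
    [TopologicalSpace (TotalSpace (EuclideanSpace ℝ (Fin m)) E)]
    [FiberBundle (EuclideanSpace ℝ (Fin m)) E] [VectorBundle ℝ (EuclideanSpace ℝ (Fin m)) E]
    [ContMDiffVectorBundle ∞ (EuclideanSpace ℝ (Fin m)) E (𝓡 n)]
    (𝔄 : LieAlgebroid n m E)
    (H : HamPhase k m E → ℝ) (hH : ContMDiff (hamModel k n m) 𝓘(ℝ) ∞ H)
    (ξ : Fin k → HamPhase.PairField k n m E) (hξ : HamPhase.IsHamiltonianSection 𝔄 H ξ)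
    (W : Set (EuclideanSpace ℝ (Fin k))) (ψ : EuclideanSpace ℝ (Fin k) → HamPhase k m E)
    (hψ : HamPhase.IsIntegralSection ξ W ψ)
    (φ : OpenPartialHomeomorph Q (EuclideanSpace ℝ (Fin n)))
    (hφ : φ ∈ IsManifold.maximalAtlas (𝓡 n) ∞ Q)
    (e : Fin m → ∀ q, E q)
    (he : IsLocalFrameOn (𝓡 n) (EuclideanSpace ℝ (Fin m)) ∞ e φ.source)
    (t : EuclideanSpace ℝ (Fin k)) (ht : t ∈ W) (hU : (ψ t).proj ∈ φ.source) :
    (∀ (i : Fin n) (A : Fin k),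
      partialT A (fun s ↦ φ (ψ s).proj i) t =
        ∑ α, 𝔄.anchorCoeff φ e i α (ψ t).proj * HamPhase.partialY φ he H A α (ψ t)) ∧
    ∀ β : Fin m,
      ∑ A, partialT A (fun s ↦ (ψ s).covector A (e β (ψ s).proj)) t =
        -(∑ i, 𝔄.anchorCoeff φ e i β (ψ t).proj * HamPhase.partialQ φ he H i (ψ t) +
          ∑ A, ∑ α, ∑ γ, (ψ t).covector A (e γ (ψ t).proj) *
            𝔄.bracketCoeff he γ β α (ψ t).proj * HamPhase.partialY φ he H A α (ψ t)) := by
  have hξt := fun A ↦ (hξ.isSection A).mem (ψ t) (mem_univ _)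
  have hφi : ∀ i, MDifferentiableAt (hamModel k n m) 𝓘(ℝ)
      (fun x : HamPhase k m E ↦ φ x.proj i) (ψ t) := fun i ↦
    ((EuclideanSpace.proj i : EuclideanSpace ℝ (Fin n) →L[ℝ] ℝ).contMDiff.contMDiffAt.comp (ψ t)
      ((contMDiffAt_of_mem_maximalAtlas hφ hU).comp (ψ t)
        (HamPhase.contMDiff_proj (ψ t)))).mdifferentiableAt (by simp)
  have hy : ∀ A β, MDifferentiableAt (hamModel k n m) 𝓘(ℝ)
      (fun x : HamPhase k m E ↦ x.covector A (e β x.proj)) (ψ t) := fun A β ↦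
    (HamPhase.contMDiffAt_covector_apply A
      (he.contMDiffAt φ.open_source hU β)).mdifferentiableAt (by simp)
  refine ⟨fun i A ↦ ?_, fun β ↦ ?_⟩
  · rw [HamPhase.partialT_comp_integralSection hψ ht (hφi i) A,
      HamPhase.dirDeriv_chart_comp_proj hφ he hU (hξt A) i]
    simp only [hξ.coeff_eq_partialY hH hφ he hU]
  · simp only [HamPhase.partialT_comp_integralSection hψ ht (hy _ β)]
    exact hξ.sum_dirDeriv_covector hH hφ he hU β
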